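/- For $S>0$, a real-valued $q\in L^2[-S,S]$ and a real $2\times 2$ matrix $M$ with $\det M>0$, consider the equation $$-y''+q(x)y=\lambda y\quad\text{on }[-S,0)\cup(0,S],\qquad \begin{pmatrix}y(0^+)\\ y'(0^+)\end{pmatrix}=M\begin{pmatrix}y(0^-)\\ y'(0^-)\end{pmatrix},\tag{1}$$ with the boundary conditions $$y(-S)\cos\alpha-y'(-S)\sin\alpha=0,\qquad y(S)\cos\beta-y'(S)\sin\beta=0,\tag{2}$$ where $\alpha\in[0,\pi)$ and $\beta\in(0,\pi]$. Let $u_\alpha(\cdot,\lambda)$, $w_\alpha(\cdot,\lambda)$ be the solutions of (1) with $u_\alpha(-S)=\cos\alpha$, $u_\alpha'(-S)=-\sin\alpha$, $w_\alpha(-S)=\sin\alpha$, $w_\alpha'(-S)=\cos\alpha$. For $\lambda\in\mathbb C$ not an eigenvalue of (1), (2), the Titchmarsh–Weyl $m$-function $m_{\alpha,\beta}(\lambda)$ is the unique number $m$ for which $u_\alpha+m\,w_\alpha$ satisfies the boundary condition at $S$ in (2). **Theorem.** Let $\lambda_0<\lambda_1<\lambda_2<\cdots$ be the eigenvalues of (1),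 (2), and let $\mu_0<\mu_1<\mu_2<\cdots$ be the eigenvalues of (1), (2) with $\alpha$ replaced by some $\alpha'\in[0,\pi)$, $\alpha'\neq\alpha$. Then $m_{\alpha,\beta}$ is uniquely reconstructed from $(\lambda_n)$, $(\mu_n)$, $\alpha$ and $\alpha'$: there is a map $R$, independent of $S$, $q$, $M$ and $\beta$, such that for all such problems and angles, $m_{\alpha,\beta}(\lambda)=R\big((\lambda_n),(\mu_n),\alpha,\alpha'\big)(\lambda)$ for every $\lambda\in\mathbb C$ that is not an eigenvalue of (1), (2). -/

import Mathlib

open MeasureTheory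

/-- The data of a Sturm-Liouville equation `-y'' + q y = z y` on `[-S, S]` with a point transfer
condition `(y(0⁺), y'(0⁺)) = M (y(0⁻), y'(0⁻))` at the origin: a half-length `S > 0`, a real
potential `q ∈ L²[-S, S]`, and a real transfer matrix `M` with positive determinant. -/
structure TransferProblem where
  S : ℝ
  S_pos : 0 < S
  q : ℝ → ℝ
  q_memLp : MemLp q 2 (volume.restrict (Set.Icc (-S) S))
  M : Matrix (Fin 2) (Fin 2) ℝ
  det_pos : 0 < M.det

/-- `y` is a (Carathéodory) solution of `-y'' + q y = z y` on `[a, b]`, with derivative `dy`: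
`y` and `dy` are continuous, `y` is a primitive of `dy`, and `dy` is a primitive of `(q - z) y`.
For `q` integrable on `[a, b]` this says that `y` is `C¹` with derivative `dy`, that `dy` is
absolutely continuous, and that the equation holds almost everywhere. -/
def SolvesOn (q : ℝ → ℝ) (z : ℂ) (a b : ℝ) (y dy : ℝ → ℂ) : Prop :=
  ContinuousOn y (Set.Icc a b) ∧ ContinuousOn dy (Set.Icc a b) ∧
    (∀ x ∈ Set.Icc a b, y x = y a + ∫ t in a..x, dy t) ∧
    (∀ x ∈ Set.Icc a b, dy x = dy a + ∫ t in a..x, ((q t : ℂ) - z) * y t)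

/-- A function `y` with its derivative on `[-S, 0) ∪ (0, S]`, each of the two pieces being extended
to the origin by its one-sided limit there: `left` is `y` on `[-S, 0]`, with `left 0 = y(0⁻)`, and
`right` is `y` on `[0, S]`, with `right 0 = y(0⁺)`; `dleft`, `dright` are the same for `y'`. -/
structure TwoSided where
  left : ℝ → ℂ
  dleft : ℝ → ℂ
  right : ℝ → ℂ
  dright : ℝ → ℂ

namespace TransferProblem

variable (P : TransferProblem)

/-- `y` solves the equation with spectral parameter `z` on both sides of the origin and obeys the
transfer condition. -/
structure IsSolution (z : ℂ) (y : TwoSided) : Prop where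
  left_eq : SolvesOn P.q z (-P.S) 0 y.left y.dleft
  right_eq : SolvesOn P.q z 0 P.S y.right y.dright
  transfer : y.right 0 = (P.M 0 0 : ℂ) * y.left 0 + (P.M 0 1 : ℂ) * y.dleft 0
  dtransfer : y.dright 0 = (P.M 1 0 : ℂ) * y.left 0 + (P.M 1 1 : ℂ) * y.dleft 0

/-- `z` is an eigenvalue of the problem with the boundary conditions
`y(-S) cos α - y'(-S) sin α = 0` and `y(S) cos β - y'(S) sin β = 0`. -/
def IsEigenvalue (α β : ℝ) (z : ℂ) : Prop :=
  ∃ y : TwoSided, P.IsSolution z y ∧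
    y.left (-P.S) * (Real.cos α : ℂ) - y.dleft (-P.S) * (Real.sin α : ℂ) = 0 ∧
    y.right P.S * (Real.cos β : ℂ) - y.dright P.S * (Real.sin β : ℂ) = 0 ∧
    ((∃ x ∈ Set.Icc (-P.S) 0, y.left x ≠ 0) ∨ (∃ x ∈ Set.Icc 0 P.S, y.right x ≠ 0))

/-- `lam 0 < lam 1 < lam 2 < ⋯` are the eigenvalues for the boundary angles `α`, `β`: the sequence
is strictly increasing and lists all eigenvalues. -/
def IsSpectrum (α β : ℝ) (lam : ℕ → ℝ) : Prop :=
  StrictMono lam ∧ ∀ z : ℂ, P.IsEigenvalue α β z ↔ ∃ n, (lam n : ℂ) = z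

/-- `m` is a value for which `u + m w` obeys the terminal condition
`y(S) cos β - y'(S) sin β = 0`, where `u`, `w` are the solutions with initial values
`u(-S) = cos α`, `u'(-S) = -sin α`, `w(-S) = sin α`, `w'(-S) = cos α`. If `z` is not an
eigenvalue, there is exactly one such `m`, the value at `z` of the Titchmarsh-Weyl `m`-function. -/
def IsWeylValue (α β : ℝ) (z m : ℂ) : Prop :=
  ∃ u w : TwoSided, P.IsSolution z u ∧ P.IsSolution z w ∧
    u.left (-P.S) = (Real.cos α : ℂ) ∧ u.dleft (-P.S) = -(Real.sin α : ℂ) ∧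
    w.left (-P.S) = (Real.sin α : ℂ) ∧ w.dleft (-P.S) = (Real.cos α : ℂ) ∧
    (u.right P.S + m * w.right P.S) * (Real.cos β : ℂ)
      - (u.dright P.S + m * w.dright P.S) * (Real.sin β : ℂ) = 0

end TransferProblem

/-! For each `z` let ψ be a nonzero solution obeying the condition at `S`, chosen entire in `z`, and
put a = ψ(-S), b = ψ'(-S). Everything is then algebra in the pair (a, b): the eigenvalues for the
angle α are the zeros of D = a cos α - b sin α, those for α' are the zeros of N = a cos α' - b sin
α', and m = (a sin α + b cos α) / D, so that N / D = cos(α - α') + sin(α - α') m. Hence it is enough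
that the two spectra determine N / D; a rule R then exists by choosing the value that any problem
with these spectra yields.

Lagrange's identity for ψ and its conjugate, with the real condition at `S` and the factor det M > 0
picked up at the origin, shows that Im(b conj a) is Im z times a positive number (`im_mul_conj_eq`).
So sin(α - α') N / D is a meromorphic Herglotz function; its zeros and poles are real, and
`deriv_mul_conj_pos` makes them simple. For two problems with the same spectra, the quotient of
these Herglotz functions extends to an entire function without zeros. It avoids the closed negative
half-line: off the real axis because both functions lie in the same half-plane, on the axis by
continuity and positivity at a common zero. Taking a square root and applying Liouville's theorem,
the quotient is a constant C (`IsHerglotzPair.proportional`).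

To see that C = 1, the m-function is compared with its leading asymptotics: b / a ~ (i - 1) t at z =
2it² (`tendsto_div`), whatever the problem. This is obtained by testing the equation on [-S, 0]
against an exponential with a cutoff vanishing doubly at the origin. The L² norm of ψ that remains
is controlled by |a| |b| through the same energy identity, so nothing about M or the right half is
needed beyond det M > 0. -/

/-! ### Primitives of integrable functions and the product rule -/

/-- A complex primitive of an integrable function is absolutely continuous. -/
theorem IntervalIntegrable.absolutelyContinuousOnInterval_const_add_integral {f : ℝ → ℂ} {a b : ℝ}
    (h : IntervalIntegrable f volume a b) (C : ℂ) :
    AbsolutelyContinuousOnInterval (fun x ↦ C + ∫ t in a..x, f t) a b := by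
  -- Increments of the complex primitive are dominated by those of the real primitive of ‖f‖, so the
  -- same δ serves.
  have key := h.norm.absolutelyContinuousOnInterval_intervalIntegral (c := a) (by simp)
  rw [absolutelyContinuousOnInterval_iff] at key ⊢
  intro ε hε
  obtain ⟨δ, hδ, hd⟩ := key ε hε
  refine ⟨δ, hδ, fun E hE hlt ↦ lt_of_le_of_lt (Finset.sum_le_sum fun i hi ↦ ?_) (hd E hE hlt)⟩
  have h1 := (hE.1 i hi).1
  have h2 := (hE.1 i hi).2
  have i1 : IntervalIntegrable f volume a (E.2 i).1 :=
    h.mono_set (Set.uIcc_subset_uIcc_left h1)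
  have i2 : IntervalIntegrable f volume a (E.2 i).2 :=
    h.mono_set (Set.uIcc_subset_uIcc_left h2)
  rw [dist_add_left, dist_eq_norm, dist_eq_norm, intervalIntegral.integral_interval_sub_left i1 i2,
    intervalIntegral.integral_interval_sub_left i1.norm i2.norm]
  exact intervalIntegral.norm_integral_le_abs_integral_norm

/-- Product rule for primitives of integrable functions. -/
theorem mul_sub_mul_eq_integral_of_primitive {f g F G : ℝ → ℂ} {a b : ℝ} (hab : a ≤ b)
    (hf : IntervalIntegrable f volume a b) (hg : IntervalIntegrable g volume a b)
    (hF : ∀ x ∈ Set.Icc a b, F x = F a + ∫ t in a..x, f t)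
    (hG : ∀ x ∈ Set.Icc a b, G x = G a + ∫ t in a..x, g t) :
    F b * G b - F a * G a = ∫ t in a..b, (f t * G t + F t * g t) := by
  -- `F` and `G` are known only on `[a, b]`, while `HasDerivAt` looks at a full neighbourhood; the
  -- primitives `F'`, `G'` are defined everywhere and agree with them on the interval.
  set F' : ℝ → ℂ := fun x ↦ F a + ∫ t in a..x, f t with hF'
  set G' : ℝ → ℂ := fun x ↦ G a + ∫ t in a..x, g t with hG'
  have acF := hf.absolutelyContinuousOnInterval_const_add_integral (F a)
  have acG := hg.absolutelyContinuousOnInterval_const_add_integral (G a)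
  have hint : IntervalIntegrable (fun t ↦ f t * G' t + F' t * g t) volume a b :=
    (hf.mul_continuousOn acG.continuousOn).add (hg.continuousOn_mul acF.continuousOn)
  have acI := hint.absolutelyContinuousOnInterval_const_add_integral 0
  have acH := (acF.smul acG).sub acI
  obtain ⟨C, hC⟩ := acH.const_of_ae_hasDerivAt_zero (by
    filter_upwards [hf.ae_hasDerivAt_integral, hg.ae_hasDerivAt_integral,
      hint.ae_hasDerivAt_integral] with x h1 h2 h3 hx
    have d1 : HasDerivAt F' (f x) x := (h1 hx a (by simp)).const_add (F a)
    have d2 : HasDerivAt G' (g x) x := (h2 hx a (by simp)).const_add (G a)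
    have d3 := (h3 hx a (by simp)).const_add (0 : ℂ)
    convert! (d1.mul d2).sub d3 using 1
    ring)
  have e1 := hC a (by simp)
  have e2 := hC b (by simp)
  have e3 : (∫ t in a..b, (f t * G t + F t * g t)) = ∫ t in a..b, (f t * G' t + F' t * g t) := by
    refine intervalIntegral.integral_congr fun t ht ↦ ?_
    rw [Set.uIcc_of_le hab] at ht
    simp only [hF', hG', ← hF t ht, ← hG t ht]
  have hb : b ∈ Set.Icc a b := ⟨hab, le_rfl⟩
  rw [e3, hF b hb, hG b hb]
  simp at e1 e2
  rw [← e1] at e2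
  linear_combination e2

/-! ### Herglotz functions with prescribed zeros and poles -/

open Filter Topology ComplexConjugate in
/-- A real zero of `N` is simple if `N / D` maps the upper half-plane to itself, and the derivative
of `N / D` there is positive. -/
theorem deriv_mul_conj_pos {N D : ℂ → ℂ} {x : ℝ} (hN : AnalyticAt ℂ N x) (hD : ContinuousAt D x)
    (h0 : N x = 0) (hDx : D x ≠ 0) (pos : ∀ z : ℂ, 0 < z.im → 0 < (N z * conj (D z)).im) :
    (deriv N x * conj (D x)).im = 0 ∧ 0 < (deriv N x * conj (D x)).re := by
  have hnz : ¬ ∀ᶠ z in 𝓝 (x : ℂ), N z = 0 := by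
    intro h
    have ht : Tendsto (fun ε : ℝ ↦ (x : ℂ) + ε * Complex.I) (𝓝[>] 0) (𝓝 (x : ℂ)) := by
      have : Continuous (fun ε : ℝ ↦ (x : ℂ) + ε * Complex.I) := by fun_prop
      simpa using (this.tendsto 0).mono_left nhdsWithin_le_nhds
    obtain ⟨ε, h1, h2⟩ := ((ht.eventually h).and self_mem_nhdsWithin).exists
    have := pos (x + ε * Complex.I) (by simpa using h2)
    simp [h1] at this
  obtain ⟨n, g, hg, hgx, hev⟩ := hN.exists_eventuallyEq_pow_smul_nonzero_iff.2 hnz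
  have hn : n ≠ 0 := by
    rintro rfl
    have := hev.self_of_nhds
    simp [h0] at this
    exact hgx this.symm
  set c := g x * conj (D x) with hc
  have hc0 : c ≠ 0 := mul_ne_zero hgx (by simpa using hDx)
  -- With N = (z - x)ⁿ g near x, approaching x along the ray of direction e^{iθ} turns the sign
  -- condition into Im(e^{inθ} c) ≥ 0 in the limit.
  have main : ∀ θ ∈ Set.Ioo 0 Real.pi, 0 ≤ (Complex.exp (n * θ * Complex.I) * c).im := by
    intro θ hθ
    set e := Complex.exp (θ * Complex.I) with he
    have him : 0 < e.im := by
      rw [he, Complex.exp_ofReal_mul_I_im]; exact Real.sin_pos_of_mem_Ioo hθ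
    have ht : Tendsto (fun ε : ℝ ↦ (x : ℂ) + ε * e) (𝓝[>] 0) (𝓝 (x : ℂ)) := by
      have : Continuous (fun ε : ℝ ↦ (x : ℂ) + ε * e) := by fun_prop
      simpa using (this.tendsto 0).mono_left nhdsWithin_le_nhds
    have hlim : Tendsto (fun ε : ℝ ↦ (e ^ n * (g (x + ε * e) * conj (D (x + ε * e)))).im)
        (𝓝[>] 0) (𝓝 (e ^ n * c).im) :=
      (Complex.continuous_im.tendsto _).comp (((hg.continuousAt.tendsto.comp ht).mul
        ((Complex.continuous_conj.tendsto _).comp (hD.tendsto.comp ht))).const_mul _)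
    have hexp : Complex.exp (n * θ * Complex.I) = e ^ n := by
      rw [he, ← Complex.exp_nat_mul]; ring_nf
    rw [hexp]
    refine ge_of_tendsto hlim ?_
    filter_upwards [ht.eventually hev, self_mem_nhdsWithin] with ε h1 h2
    have h2 : 0 < ε := h2
    have h3 := pos (x + ε * e) (by simpa using mul_pos h2 him)
    rw [h1] at h3
    have h4 : (x + ε * e - x) ^ n • g (x + ε * e) * conj (D (x + ε * e)) =
        ((ε ^ n : ℝ) : ℂ) * (e ^ n * (g (x + ε * e) * conj (D (x + ε * e)))) := by
      push_cast; rw [add_sub_cancel_left, smul_eq_mul, mul_pow]; ring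
    rw [h4, Complex.im_ofReal_mul] at h3
    exact (pos_of_mul_pos_right h3 (by positivity)).le
  have main' : ∀ θ ∈ Set.Icc 0 Real.pi, 0 ≤ (Complex.exp (n * θ * Complex.I) * c).im := by
    intro θ hθ
    have hcl : IsClosed {θ : ℝ | 0 ≤ (Complex.exp (n * θ * Complex.I) * c).im} :=
      isClosed_le continuous_const (by fun_prop)
    have := hcl.closure_subset_iff.2 (fun θ h ↦ main θ h : Set.Ioo 0 Real.pi ⊆ _)
    rw [closure_Ioo Real.pi_pos.ne] at this
    exact this hθ
  have hn' : (n : ℝ) ≠ 0 := by exact_mod_cast hn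
  have hnc : (n : ℂ) ≠ 0 := by exact_mod_cast hn
  have hn1 : (1 : ℝ) ≤ n := by exact_mod_cast Nat.one_le_iff_ne_zero.2 hn
  -- The angle φ = nθ sweeps [0, nπ]. The values 0 and π force Im c = 0, and π/2 gives Re c > 0 as c
  -- ≠ 0; if n ≥ 2, then 3π/2 is also reached and gives Re c ≤ 0.
  have val : ∀ φ : ℝ, 0 ≤ φ → φ ≤ n * Real.pi → 0 ≤ Real.sin φ * c.re + Real.cos φ * c.im := by
    intro φ h1 h2
    have := main' (φ / n) ⟨by positivity, by rw [div_le_iff₀ (by positivity)]; linarith⟩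
    have e1 : (n : ℂ) * ((φ / n : ℝ) : ℂ) = (φ : ℝ) := by push_cast; field_simp
    rw [e1, Complex.mul_im, Complex.exp_ofReal_mul_I_im, Complex.exp_ofReal_mul_I_re] at this
    linarith
  have hpi := Real.pi_pos
  have v0 := val 0 le_rfl (by positivity)
  have v1 := val Real.pi hpi.le (by nlinarith)
  have v2 := val (Real.pi / 2) (by positivity) (by nlinarith)
  simp at v0 v1 v2
  have him : c.im = 0 := le_antisymm v1 v0
  have hre : 0 < c.re := lt_of_le_of_ne v2 fun h ↦ hc0 (Complex.ext h.symm him)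
  have hn2 : n = 1 := by
    by_contra h
    have h2 : (2 : ℝ) ≤ n := by exact_mod_cast (by omega : 2 ≤ n)
    have v3 := val (3 * Real.pi / 2) (by positivity) (by nlinarith)
    have : Real.sin (3 * Real.pi / 2) = -1 := by
      rw [show 3 * Real.pi / 2 = Real.pi / 2 + Real.pi by ring, Real.sin_add_pi]; simp
    rw [this, him] at v3
    linarith
  subst hn2
  have hd : deriv N x = g x := by
    rw [Filter.EventuallyEq.deriv_eq (f := fun z : ℂ ↦ (z - (x : ℂ)) ^ 1 • g z) hev]
    have := ((hasDerivAt_id (x : ℂ)).sub_const (x : ℂ)).mul hg.differentiableAt.hasDerivAt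
    simpa [Pi.mul_def] using this.deriv
  rw [hd]
  exact ⟨him, hre⟩

open Filter Topology in
/-- The quotient of two entire functions with the same simple zeros extends to an entire function. -/
theorem differentiable_quotient_extension {f g : ℂ → ℂ} (hf : Differentiable ℂ f)
    (hg : Differentiable ℂ g) (hfg : ∀ z, g z = 0 → f z = 0)
    (hg' : ∀ z, g z = 0 → deriv g z ≠ 0) :
    Differentiable ℂ (fun z ↦ if g z = 0 then deriv f z / deriv g z else f z / g z) := by
  classical
  intro x
  by_cases hx : g x = 0
  · have hds : ∀ {h : ℂ → ℂ}, Differentiable ℂ h → DifferentiableAt ℂ (dslope h x) x := fun hh ↦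
      ((Complex.differentiableOn_dslope (s := Set.univ) univ_mem).2
        hh.differentiableOn).differentiableAt univ_mem
    -- Dividing the common factor z - x out of both functions leaves a quotient of difference
    -- quotients that is analytic at x, with the ratio of derivatives as its value there.
    have h1 : DifferentiableAt ℂ (fun z ↦ dslope f x z / dslope g x z) x :=
      (hds hf).div (hds hg) (by rw [dslope_same]; exact hg' x hx)
    refine h1.congr_of_eventuallyEq ?_
    have hne : ∀ᶠ z in 𝓝[≠] x, g z ≠ 0 :=
      hx ▸ (hg x).hasDerivAt.eventually_ne (hg' x hx)
    have : ∀ᶠ z in 𝓝[≠] x, (if g z = 0 then deriv f z / deriv g z else f z / g z) =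
        dslope f x z / dslope g x z := by
      filter_upwards [hne, self_mem_nhdsWithin] with z hz hzx
      have hzx : z ≠ x := hzx
      rw [if_neg hz, dslope_of_ne _ hzx, dslope_of_ne _ hzx, slope_def_field, slope_def_field,
        hfg x hx, hx, sub_zero, sub_zero, div_div_div_cancel_right₀ (sub_ne_zero.2 hzx)]
    rw [eventually_nhdsWithin_iff] at this
    filter_upwards [this] with z hz
    by_cases hzx : z = x
    · subst hzx; simp [hx]
    · exact hz hzx
  · refine (((hf x).div (hg x) hx)).congr_of_eventuallyEq ?_
    filter_upwards [(hg x).continuousAt.eventually_ne hx] with z hz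
    simp [hz]

/-- An entire function that avoids the closed negative half-line is constant. -/
theorem Differentiable.exists_const_of_mem_slitPlane {G : ℂ → ℂ} (hG : Differentiable ℂ G)
    (h : ∀ z, G z ∈ Complex.slitPlane) : ∃ C, ∀ z, G z = C := by
  -- The principal square root of `G` is entire with positive real part, so 1 / (1 + H) is bounded
  -- and Liouville's theorem applies.
  set H : ℂ → ℂ := fun z ↦ Complex.exp (Complex.log (G z) / 2) with hH
  have hHd : Differentiable ℂ H := fun z ↦ (((hG z).clog (h z)).div_const 2).cexp
  have hre : ∀ z, 0 < (H z).re := by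
    intro z
    rw [hH]
    simp only
    rw [Complex.exp_re]
    have h2 : (Complex.log (G z) / 2).im = (G z).arg / 2 := by simp [Complex.log_im]
    rw [h2]
    have h3 := Complex.neg_pi_lt_arg (G z)
    have h4 := lt_of_le_of_ne (Complex.arg_le_pi (G z)) (Complex.slitPlane_arg_ne_pi (h z))
    exact mul_pos (Real.exp_pos _) (Real.cos_pos_of_mem_Ioo ⟨by linarith, by linarith⟩)
  have hsq : ∀ z, G z = H z ^ 2 := by
    intro z
    rw [hH]
    simp only
    rw [← Complex.exp_nat_mul]
    push_cast
    rw [mul_div_cancel₀ _ (two_ne_zero' ℂ), Complex.exp_log (Complex.slitPlane_ne_zero (h z))]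
  have hn : ∀ z, 1 ≤ ‖1 + H z‖ := fun z ↦ by
    have := Complex.re_le_norm (1 + H z)
    simp at this
    linarith [hre z]
  have hb : Bornology.IsBounded (Set.range fun z ↦ (1 + H z)⁻¹) := by
    rw [isBounded_iff_forall_norm_le]
    refine ⟨1, ?_⟩
    rintro _ ⟨z, rfl⟩
    rw [norm_inv]
    exact inv_le_one_of_one_le₀ (hn z)
  have hd : Differentiable ℂ fun z ↦ (1 + H z)⁻¹ := fun z ↦
    ((hHd z).const_add 1).inv fun h0 ↦ by have := hn z; rw [h0] at this; norm_num at this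
  refine ⟨H 0 ^ 2, fun z ↦ ?_⟩
  have := inv_injective (hd.apply_eq_apply_of_bounded hb z 0)
  rw [hsq, add_left_cancel this]

/-- `N / D` is a meromorphic Herglotz function written as a quotient of entire functions with real
zeros and no common zeros. -/
structure IsHerglotzPair (N D : ℂ → ℂ) : Prop where
  num : Differentiable ℂ N
  den : Differentiable ℂ D
  num_zero_im : ∀ z, N z = 0 → z.im = 0
  den_zero_im : ∀ z, D z = 0 → z.im = 0
  not_both : ∀ z, N z = 0 → D z ≠ 0
  im_pos : ∀ z : ℂ, 0 < z.im → 0 < (N z * (starRingEnd ℂ) (D z)).im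
  im_neg : ∀ z : ℂ, z.im < 0 → (N z * (starRingEnd ℂ) (D z)).im < 0
  im_zero : ∀ z : ℂ, z.im = 0 → (N z * (starRingEnd ℂ) (D z)).im = 0

namespace IsHerglotzPair

variable {N D : ℂ → ℂ}

/-- The map w ↦ -1/w preserves the upper half-plane. This carries every statement about zeros over
to poles. -/
theorem swap (h : IsHerglotzPair N D) : IsHerglotzPair (fun z ↦ -D z) N where
  num := h.den.neg
  den := h.num
  num_zero_im z hz := h.den_zero_im z (by simpa using hz)
  den_zero_im := h.num_zero_im
  not_both z hz hN := h.not_both z hN (by simpa using hz)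
  im_pos z hz := by have := h.im_pos z hz; simp at this ⊢; linarith
  im_neg z hz := by have := h.im_neg z hz; simp at this ⊢; linarith
  im_zero z hz := by have := h.im_zero z hz; simp at this ⊢; linarith

theorem deriv_num (h : IsHerglotzPair N D) {z : ℂ} (hz : N z = 0) :
    (deriv N z * (starRingEnd ℂ) (D z)).im = 0 ∧ 0 < (deriv N z * (starRingEnd ℂ) (D z)).re := by
  obtain ⟨x, rfl⟩ : ∃ x : ℝ, (x : ℂ) = z := ⟨z.re, Complex.ext rfl (h.num_zero_im z hz).symm⟩
  exact deriv_mul_conj_pos (h.num.analyticAt _) h.den.continuous.continuousAt hz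
    (h.not_both _ hz) h.im_pos

theorem deriv_num_ne_zero (h : IsHerglotzPair N D) {z : ℂ} (hz : N z = 0) : deriv N z ≠ 0 := by
  intro h0
  have := (h.deriv_num hz).2
  simp [h0] at this

end IsHerglotzPair

/-- Rewriting a quotient `(n₁ / n₂) (d₂ / d₁)` through the products `nᵢ conj dᵢ`. -/
theorem div_mul_div_eq_mul_conj (n₁ d₁ n₂ d₂ : ℂ) (h₁ : d₁ ≠ 0) (h₂ : d₂ ≠ 0) (hn : n₂ ≠ 0) :
    n₁ / n₂ * (d₂ / d₁) = ((Complex.normSq d₂ / Complex.normSq d₁ : ℝ) : ℂ) *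
      ((n₁ * (starRingEnd ℂ) d₁) / (n₂ * (starRingEnd ℂ) d₂)) := by
  have c1 : (starRingEnd ℂ) d₁ ≠ 0 := by simpa using h₁
  have c2 : (starRingEnd ℂ) d₂ ≠ 0 := by simpa using h₂
  push_cast
  rw [Complex.normSq_eq_conj_mul_self, Complex.normSq_eq_conj_mul_self]
  field_simp

/-- A quotient of two complex numbers whose imaginary parts have the same sign is not a
nonpositive real number. -/
theorem div_mem_slitPlane_of_im_mul_pos {a b : ℂ} (h : 0 < a.im * b.im) :
    a / b ∈ Complex.slitPlane := by
  have hb : b ≠ 0 := by rintro rfl; simp at h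
  rw [Complex.mem_slitPlane_iff]
  by_contra! hc
  have e : a = ((a / b).re : ℂ) * b := by
    rw [show ((a / b).re : ℂ) = a / b from Complex.ext rfl (by simp [hc.2]), div_mul_cancel₀ _ hb]
  have e2 : a.im = (a / b).re * b.im := by
    conv_lhs => rw [e]
    simp
  rw [e2] at h
  nlinarith [mul_self_nonneg b.im, hc.1]

theorem ofReal_mul_mem_slitPlane {r : ℝ} (hr : 0 < r) {z : ℂ} (hz : z ∈ Complex.slitPlane) :
    (r : ℂ) * z ∈ Complex.slitPlane := by
  rw [Complex.mem_slitPlane_iff] at hz ⊢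
  rcases hz with hz | hz
  · left; simpa using mul_pos hr hz
  · right; simpa using ⟨hr.ne', hz⟩

/-- Two complex numbers with zero imaginary part and positive real part have a quotient of the
same kind. -/
theorem div_re_pos_im_zero {a b : ℂ} (ha : a.im = 0) (hb : b.im = 0) :
    (a / b).im = 0 ∧ (0 < a.re → 0 < b.re → 0 < (a / b).re) := by
  have ea : a = (a.re : ℂ) := Complex.ext rfl (by simp [ha])
  have eb : b = (b.re : ℂ) := Complex.ext rfl (by simp [hb])
  rw [ea, eb, ← Complex.ofReal_div]
  exact ⟨Complex.ofReal_im _, fun h1 h2 ↦ by simpa using div_pos h1 h2⟩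

open Classical in
/-- Two meromorphic Herglotz functions with the same zeros and the same poles, of which there is at
least one zero, are proportional. -/
theorem IsHerglotzPair.proportional {N₁ D₁ N₂ D₂ : ℂ → ℂ} (h₁ : IsHerglotzPair N₁ D₁)
    (h₂ : IsHerglotzPair N₂ D₂) (hN : ∀ z, N₁ z = 0 ↔ N₂ z = 0) (hD : ∀ z, D₁ z = 0 ↔ D₂ z = 0)
    (hz : ∃ z, N₁ z = 0) : ∃ C : ℂ, ∀ z, N₁ z * D₂ z = C * (D₁ z * N₂ z) := by
  -- The product A B is the quotient of the two Herglotz functions with all removable singularities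
  -- filled in, zeros by `A` and poles by `B`.
  set A : ℂ → ℂ := fun z ↦ if N₂ z = 0 then deriv N₁ z / deriv N₂ z else N₁ z / N₂ z with hA
  set B : ℂ → ℂ := fun z ↦ if D₁ z = 0 then deriv D₂ z / deriv D₁ z else D₂ z / D₁ z with hB
  have hder : ∀ {N D : ℂ → ℂ}, IsHerglotzPair N D → ∀ {z}, D z = 0 → deriv D z ≠ 0 := by
    intro N D h z hz
    have := h.swap.deriv_num_ne_zero (z := z) (by simpa using hz)
    rwa [deriv.fun_neg, neg_ne_zero] at this
  have hAd : Differentiable ℂ A := differentiable_quotient_extension h₁.num h₂.num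
    (fun z ↦ (hN z).2) fun z h ↦ h₂.deriv_num_ne_zero h
  have hBd : Differentiable ℂ B := differentiable_quotient_extension h₂.den h₁.den
    (fun z ↦ (hD z).1) fun z h ↦ hder h₁ h
  have hposN : ∀ z, N₁ z = 0 → (A z * B z).im = 0 ∧ 0 < (A z * B z).re := by
    intro z h
    have h' := (hN z).1 h
    have hd1 := h₁.not_both z h
    have hd2 := h₂.not_both z h'
    simp only [hA, hB, if_pos h', if_neg hd1]
    rw [div_mul_div_eq_mul_conj _ _ _ _ hd1 hd2 (h₂.deriv_num_ne_zero h')]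
    have q1 := h₁.deriv_num h
    have q2 := h₂.deriv_num h'
    have q := div_re_pos_im_zero q1.1 q2.1
    have hr : 0 < Complex.normSq (D₂ z) / Complex.normSq (D₁ z) :=
      div_pos (Complex.normSq_pos.2 hd2) (Complex.normSq_pos.2 hd1)
    rw [Complex.im_ofReal_mul, Complex.re_ofReal_mul, q.1]
    exact ⟨by simp, mul_pos hr (q.2 q1.2 q2.2)⟩
  -- At a common pole it suffices that A B is real and nonzero; its sign there follows later from
  -- the sign at a zero.
  have hposD : ∀ z, D₁ z = 0 → (A z * B z).im = 0 ∧ A z * B z ≠ 0 := by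
    intro z h
    have h' := (hD z).1 h
    have hn1 : N₁ z ≠ 0 := fun h0 ↦ h₁.not_both z h0 h
    have hn2 : N₂ z ≠ 0 := fun h0 ↦ h₂.not_both z h0 h'
    refine ⟨?_, ?_⟩
    · simp only [hA, hB, if_pos h, if_neg hn2]
      have e : N₁ z / N₂ z * (deriv D₂ z / deriv D₁ z) =
          deriv (fun z ↦ -D₂ z) z / deriv (fun z ↦ -D₁ z) z * (N₁ z / N₂ z) := by
        rw [deriv.fun_neg, deriv.fun_neg, neg_div_neg_eq, mul_comm]
      have k1 : -D₁ z = 0 := by simpa using h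
      have k2 : -D₂ z = 0 := by simpa using h'
      rw [e, div_mul_div_eq_mul_conj _ _ _ _ hn2 hn1 (h₁.swap.deriv_num_ne_zero k1)]
      have q := div_re_pos_im_zero (h₂.swap.deriv_num k2).1 (h₁.swap.deriv_num k1).1
      rw [Complex.im_ofReal_mul, q.1, mul_zero]
    · simp only [hA, hB, if_pos h, if_neg hn2]
      exact mul_ne_zero (div_ne_zero hn1 hn2) (div_ne_zero (hder h₂ h') (hder h₁ h))
  have hgen : ∀ z, N₁ z ≠ 0 → D₁ z ≠ 0 → A z * B z = N₁ z / N₂ z * (D₂ z / D₁ z) := by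
    intro z h h'
    simp only [hA, hB, if_neg ((hN z).not.1 h), if_neg h']
  have hne : ∀ z, A z * B z ≠ 0 := by
    intro z h0
    by_cases h : N₁ z = 0
    · have := (hposN z h).2; simp [h0] at this
    by_cases h' : D₁ z = 0
    · exact (hposD z h').2 h0
    rw [hgen z h h'] at h0
    exact mul_ne_zero (div_ne_zero h ((hN z).not.1 h)) (div_ne_zero ((hD z).not.1 h') h') h0
  have hreal : ∀ x : ℝ, (A x * B x).im = 0 := by
    intro x
    by_cases h : N₁ x = 0
    · exact (hposN x h).1
    by_cases h' : D₁ x = 0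
    · exact (hposD x h').1
    rw [hgen x h h', div_mul_div_eq_mul_conj _ _ _ _ h' ((hD x).not.1 h') ((hN x).not.1 h)]
    have q := div_re_pos_im_zero (h₁.im_zero x (by simp)) (h₂.im_zero x (by simp))
    rw [Complex.im_ofReal_mul, q.1, mul_zero]
  have hABd : Differentiable ℂ fun z ↦ A z * B z := hAd.mul hBd
  obtain ⟨z₀, hz₀⟩ := hz
  obtain ⟨x₀, rfl⟩ : ∃ x : ℝ, (x : ℂ) = z₀ :=
    ⟨z₀.re, Complex.ext rfl (h₁.num_zero_im z₀ hz₀).symm⟩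
  -- On the real line A B is continuous, real and nowhere zero, so by the intermediate value theorem
  -- it keeps the sign it has at the zero x₀.
  have hpos : ∀ x : ℝ, 0 < (A x * B x).re := by
    intro x
    by_contra! hx
    have hc : Continuous fun x : ℝ ↦ (A x * B x).re :=
      Complex.continuous_re.comp (hABd.continuous.comp Complex.continuous_ofReal)
    obtain ⟨y, hy⟩ := mem_range_of_exists_le_of_exists_ge hc ⟨x, hx⟩ ⟨x₀, (hposN _ hz₀).2.le⟩
    exact hne y (Complex.ext hy (hreal y))
  have hslit : ∀ z, A z * B z ∈ Complex.slitPlane := by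
    intro z
    by_cases him : z.im = 0
    · obtain ⟨x, rfl⟩ : ∃ x : ℝ, (x : ℂ) = z := ⟨z.re, Complex.ext rfl him.symm⟩
      exact Complex.mem_slitPlane_iff.2 (Or.inl (hpos x))
    · have hd1 : D₁ z ≠ 0 := fun h ↦ him (h₁.den_zero_im z h)
      have hn1 : N₁ z ≠ 0 := fun h ↦ him (h₁.num_zero_im z h)
      have hd2 := (hD z).not.1 hd1
      rw [hgen z hn1 hd1, div_mul_div_eq_mul_conj _ _ _ _ hd1 hd2 ((hN z).not.1 hn1)]
      refine ofReal_mul_mem_slitPlane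
        (div_pos (Complex.normSq_pos.2 hd2) (Complex.normSq_pos.2 hd1))
        (div_mem_slitPlane_of_im_mul_pos ?_)
      rcases lt_or_gt_of_ne him with h | h
      · exact mul_pos_of_neg_of_neg (h₁.im_neg z h) (h₂.im_neg z h)
      · exact mul_pos (h₁.im_pos z h) (h₂.im_pos z h)
  obtain ⟨C, hC⟩ := hABd.exists_const_of_mem_slitPlane hslit
  refine ⟨C, fun z ↦ ?_⟩
  have eA : A z * N₂ z = N₁ z := by
    simp only [hA]
    split_ifs with h
    · rw [h, mul_zero, (hN z).2 h]
    · exact div_mul_cancel₀ _ h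
  have eB : B z * D₁ z = D₂ z := by
    simp only [hB]
    split_ifs with h
    · rw [h, mul_zero, (hD z).1 h]
    · exact div_mul_cancel₀ _ h
  rw [← hC z, ← eA, ← eB]
  ring

/-! ### Initial value problems as Volterra equations -/

theorem differentiable_sub_smul {E : Type*} [NormedAddCommGroup E] [NormedSpace ℂ E] (A B : E) :
    Differentiable ℂ fun z : ℂ ↦ A - z • B := by fun_prop

theorem differentiable_one_sub_comp_sub_smul {E : Type*} [NormedAddCommGroup E] [NormedSpace ℂ E]
    (V A B : E →L[ℂ] E) : Differentiable ℂ fun z : ℂ ↦ 1 - V.comp (A - z • B) :=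
  (differentiable_const _).sub ((differentiable_const _).clm_comp (differentiable_sub_smul A B))

section Volterra

variable {a b : ℝ} (hab : a ≤ b)

theorem intervalIntegrable_mul_IccExtend {p : ℝ → ℂ} (hp : IntervalIntegrable p volume a b)
    (f : C(Set.Icc a b, ℂ)) :
    IntervalIntegrable (fun t ↦ p t * Set.IccExtend hab f t) volume a b :=
  hp.mul_continuousOn (f.continuous.Icc_extend' (h := hab)).continuousOn

theorem norm_IccExtend_le (f : C(Set.Icc a b, ℂ)) (t : ℝ) : ‖Set.IccExtend hab f t‖ ≤ ‖f‖ :=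
  f.norm_coe_le_norm _

theorem intervalIntegrable_left_of_mem {p : ℝ → ℂ} (hp : IntervalIntegrable p volume a b)
    {x : ℝ} (hx : x ∈ Set.Icc a b) : IntervalIntegrable p volume a x :=
  hp.mono_set (by rw [Set.uIcc_of_le hx.1, Set.uIcc_of_le (hx.1.trans hx.2)]
                  exact Set.Icc_subset_Icc_right hx.2)

theorem integral_norm_le_of_mem {p : ℝ → ℂ} (hp : IntervalIntegrable p volume a b)
    {x : ℝ} (hx : x ∈ Set.Icc a b) : ∫ t in a..x, ‖p t‖ ≤ ∫ t in a..b, ‖p t‖ :=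
  intervalIntegral.integral_mono_interval le_rfl hx.1 hx.2
    (Filter.Eventually.of_forall fun _ ↦ norm_nonneg _) hp.norm

/-- The operator `f ↦ ∫ t in a..x, p t * f t` on continuous functions. -/
noncomputable def volterra {p : ℝ → ℂ} (hp : IntervalIntegrable p volume a b) :
    C(Set.Icc a b, ℂ) →L[ℂ] C(Set.Icc a b, ℂ) :=
  LinearMap.mkContinuous
    { toFun := fun f ↦ ⟨fun x ↦ ∫ t in a..x, p t * Set.IccExtend hab f t, by
        have h := intervalIntegral.continuousOn_primitive_interval'
          (intervalIntegrable_mul_IccExtend hab hp f) (Set.left_mem_uIcc)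
        rw [Set.uIcc_of_le hab] at h
        exact h.comp_continuous continuous_subtype_val fun x ↦ x.2⟩
      map_add' := fun f g ↦ by
        ext x
        have hf := intervalIntegrable_left_of_mem (intervalIntegrable_mul_IccExtend hab hp f) x.2
        have hg := intervalIntegrable_left_of_mem (intervalIntegrable_mul_IccExtend hab hp g) x.2
        simp only [ContinuousMap.coe_mk, ContinuousMap.add_apply]
        rw [← intervalIntegral.integral_add hf hg]
        simp [Set.IccExtend, mul_add]
      map_smul' := fun c f ↦ by
        ext x
        simp only [ContinuousMap.coe_mk, ContinuousMap.smul_apply, RingHom.id_apply, smul_eq_mul]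
        rw [← intervalIntegral.integral_const_mul]
        refine intervalIntegral.integral_congr fun t _ ↦ ?_
        simp [Set.IccExtend]
        ring }
    (∫ t in a..b, ‖p t‖) fun f ↦ by
      have h0 : 0 ≤ ∫ t in a..b, ‖p t‖ :=
        intervalIntegral.integral_nonneg hab fun _ _ ↦ norm_nonneg _
      refine (ContinuousMap.norm_le _ (by positivity)).2 fun x ↦ ?_
      refine (intervalIntegral.norm_integral_le_integral_norm x.2.1).trans ?_
      calc ∫ t in a..x, ‖p t * Set.IccExtend hab f t‖ ≤ ∫ t in a..x, ‖p t‖ * ‖f‖ := by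
            refine intervalIntegral.integral_mono_on x.2.1
              (intervalIntegrable_left_of_mem (intervalIntegrable_mul_IccExtend hab hp f) x.2).norm
              ((intervalIntegrable_left_of_mem hp x.2).norm.mul_const _) fun t _ ↦ ?_
            rw [norm_mul]
            exact mul_le_mul_of_nonneg_left (norm_IccExtend_le hab f t) (norm_nonneg _)
        _ ≤ _ := by
            rw [intervalIntegral.integral_mul_const]
            exact mul_le_mul_of_nonneg_right (integral_norm_le_of_mem hp x.2) (norm_nonneg _)

theorem volterra_apply {p : ℝ → ℂ} (hp : IntervalIntegrable p volume a b)
    (f : C(Set.Icc a b, ℂ)) (x : Set.Icc a b) :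
    volterra hab hp f x = ∫ t in a..x, p t * Set.IccExtend hab f t := rfl

/-- The exponential weight `x ↦ exp (K (x - a))`. -/
noncomputable def expWeight (a b K : ℝ) : C(Set.Icc a b, ℂ) :=
  ⟨fun x ↦ Complex.exp ((K * (x - a) : ℝ)), by fun_prop⟩

theorem expWeight_neg_mul (K : ℝ) : expWeight a b (-K) * expWeight a b K = 1 := by
  ext x
  simp [expWeight, ← Complex.exp_add]

/-- Two-fold integration with an integrable weight is a quasi-nilpotent operator. -/
theorem isUnit_one_sub_volterra_comp {p : ℝ → ℂ} (hp : IntervalIntegrable p volume a b) :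
    IsUnit (1 - (volterra hab (p := fun _ ↦ 1) intervalIntegrable_const).comp
      (volterra hab hp)) := by
  set T := (volterra hab (p := fun _ ↦ 1) intervalIntegrable_const).comp (volterra hab hp) with hT
  set C := ∫ t in a..b, ‖p t‖ with hC
  have hC0 : 0 ≤ C := intervalIntegral.integral_nonneg hab fun _ _ ↦ norm_nonneg _
  -- Conjugation by the weight e^{K(x - a)} brings the norm of the operator down to at most C / K,
  -- which is below 1 for any K > C.
  set K := C + 1 with hK
  have hK0 : 0 < K := by linarith
  set E := ContinuousLinearMap.mul ℂ C(Set.Icc a b, ℂ) (expWeight a b K) with hE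
  set E' := ContinuousLinearMap.mul ℂ C(Set.Icc a b, ℂ) (expWeight a b (-K)) with hE'
  have h1 : E' * E = 1 := by
    ext f x
    have : expWeight a b (-K) * (expWeight a b K * f) = f := by
      rw [← mul_assoc, expWeight_neg_mul, one_mul]
    exact congrArg (· x) this
  have h2 : E * E' = 1 := by
    ext f x
    have : expWeight a b K * (expWeight a b (-K) * f) = f := by
      rw [← mul_assoc, mul_comm (expWeight a b K), expWeight_neg_mul, one_mul]
    exact congrArg (· x) this
  have hnorm : ‖E' * (T * E)‖ < 1 := by
    refine lt_of_le_of_lt (ContinuousLinearMap.opNorm_le_bound _ (M := C / K) (by positivity)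
      fun f ↦ ?_) ((div_lt_one hK0).2 (by linarith))
    refine (ContinuousMap.norm_le _ (by positivity)).2 fun x ↦ ?_
    set g : C(Set.Icc a b, ℂ) := expWeight a b K * f with hg
    have hgn : ∀ s ∈ Set.Icc a b, ∀ t ∈ Set.Icc a s,
        ‖Set.IccExtend hab g t‖ ≤ Real.exp (K * (s - a)) * ‖f‖ := by
      intro s hs t ht
      rw [Set.IccExtend_of_mem hab _ ⟨ht.1, ht.2.trans hs.2⟩, hg, ContinuousMap.mul_apply, norm_mul]
      refine mul_le_mul ?_ (f.norm_coe_le_norm _) (norm_nonneg _) (Real.exp_pos _).le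
      rw [expWeight, ContinuousMap.coe_mk, Complex.norm_exp_ofReal]
      exact Real.exp_le_exp.2 (mul_le_mul_of_nonneg_left (by linarith [ht.2]) hK0.le)
    have inner : ∀ s ∈ Set.Icc a b,
        ‖Set.IccExtend hab (volterra hab hp g) s‖ ≤ C * (Real.exp (K * (s - a)) * ‖f‖) := by
      intro s hs
      rw [Set.IccExtend_of_mem hab _ hs, volterra_apply]
      refine (intervalIntegral.norm_integral_le_integral_norm hs.1).trans ?_
      calc ∫ t in a..s, ‖p t * Set.IccExtend hab g t‖
          ≤ ∫ t in a..s, ‖p t‖ * (Real.exp (K * (s - a)) * ‖f‖) := by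
            refine intervalIntegral.integral_mono_on hs.1
              (intervalIntegrable_left_of_mem (intervalIntegrable_mul_IccExtend hab hp g) hs).norm
              ((intervalIntegrable_left_of_mem hp hs).norm.mul_const _) fun t ht ↦ ?_
            rw [norm_mul]
            exact mul_le_mul_of_nonneg_left (hgn s hs t ht) (norm_nonneg _)
        _ ≤ _ := by
            rw [intervalIntegral.integral_mul_const]
            exact mul_le_mul_of_nonneg_right (integral_norm_le_of_mem hp hs) (by positivity)
    have outer : ‖T g x‖ ≤ C * ‖f‖ / K * Real.exp (K * (x - a)) := by
      have hd : ∀ s ∈ Set.uIcc a (x : ℝ), HasDerivAt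
          (fun s ↦ C * ‖f‖ / K * Real.exp (K * (s - a))) (C * (Real.exp (K * (s - a)) * ‖f‖)) s := by
        intro s _
        have := ((((hasDerivAt_id s).sub_const a).const_mul K).exp).const_mul (C * ‖f‖ / K)
        refine this.congr_deriv ?_
        have := hK0.ne'
        simp only [id]
        field_simp
      have hint : IntervalIntegrable (fun s ↦ C * (Real.exp (K * (s - a)) * ‖f‖)) volume a x :=
        (by fun_prop : Continuous _).intervalIntegrable _ _
      have e := intervalIntegral.integral_eq_sub_of_hasDerivAt hd hint
      have : T g x = ∫ s in a..x, 1 * Set.IccExtend hab (volterra hab hp g) s := rfl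
      rw [this]
      refine (intervalIntegral.norm_integral_le_of_norm_le (g := fun s ↦
        C * (Real.exp (K * (s - a)) * ‖f‖)) x.2.1 ?_ hint).trans ?_
      · filter_upwards with s hs
        rw [one_mul]
        exact inner s ⟨hs.1.le, hs.2.trans x.2.2⟩
      · rw [e]
        have : 0 ≤ C * ‖f‖ / K * Real.exp (K * (a - a)) := by positivity
        linarith
    have e : (E' * (T * E)) f x = Complex.exp ((-K * (x - a) : ℝ)) * T g x := rfl
    rw [e, norm_mul, Complex.norm_exp_ofReal]
    calc Real.exp (-K * (x - a)) * ‖T g x‖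
        ≤ Real.exp (-K * (x - a)) * (C * ‖f‖ / K * Real.exp (K * (x - a))) :=
          mul_le_mul_of_nonneg_left outer (Real.exp_pos _).le
      _ = C / K * ‖f‖ * (Real.exp (-K * (x - a)) * Real.exp (K * (x - a))) := by ring
      _ = C / K * ‖f‖ := by rw [← Real.exp_add]; simp
  have hu := isUnit_one_sub_of_norm_lt_one (x := E' * (T * E)) hnorm
  let u : (C(Set.Icc a b, ℂ) →L[ℂ] C(Set.Icc a b, ℂ))ˣ := ⟨E, E', h2, h1⟩
  have e : 1 - T = u * (1 - E' * (T * E)) * (u⁻¹ : _ˣ) := by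
    change 1 - T = E * (1 - E' * (T * E)) * E'
    calc 1 - T = E * E' - (E * E') * T * (E * E') := by rw [h2]; simp
      _ = _ := by simp only [mul_sub, sub_mul, mul_one, mul_assoc]
  rw [e]
  exact (u.isUnit.mul hu).mul (u⁻¹).isUnit

variable {q : ℝ → ℝ}

theorem intervalIntegrable_ofReal (hq : IntervalIntegrable q volume a b) :
    IntervalIntegrable (fun t ↦ (q t : ℂ)) volume a b := ⟨hq.1.ofReal, hq.2.ofReal⟩

theorem intervalIntegrable_ofReal_sub_const (hq : IntervalIntegrable q volume a b) (z : ℂ) :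
    IntervalIntegrable (fun t ↦ (q t : ℂ) - z) volume a b :=
  (intervalIntegrable_ofReal hq).sub intervalIntegrable_const

/-- The integral operator whose fixed-point equation is `-y'' + q y = z y`. -/
noncomputable def sturmOp (hq : IntervalIntegrable q volume a b) (z : ℂ) :
    C(Set.Icc a b, ℂ) →L[ℂ] C(Set.Icc a b, ℂ) :=
  (volterra hab (p := fun _ ↦ 1) intervalIntegrable_const).comp
    (volterra hab (intervalIntegrable_ofReal_sub_const hq z))

/-- Dependence on the spectral parameter is affine; this is the source of analyticity in `z`. -/
theorem volterra_ofReal_sub_const (hq : IntervalIntegrable q volume a b) (z : ℂ) :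
    volterra hab (intervalIntegrable_ofReal_sub_const hq z) =
      volterra hab (intervalIntegrable_ofReal hq) - z • volterra hab (p := fun _ ↦ 1) intervalIntegrable_const := by
  ext f x
  have h1 := intervalIntegrable_left_of_mem (intervalIntegrable_mul_IccExtend hab (intervalIntegrable_ofReal hq) f) x.2
  have h2 := intervalIntegrable_left_of_mem
    (intervalIntegrable_mul_IccExtend hab (p := fun _ ↦ 1) intervalIntegrable_const f) x.2
  change _ = volterra hab (intervalIntegrable_ofReal hq) f x - z * volterra hab _ f x
  rw [volterra_apply, volterra_apply, volterra_apply, ← intervalIntegral.integral_const_mul,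
    ← intervalIntegral.integral_sub h1 (h2.const_mul z)]
  refine intervalIntegral.integral_congr fun t _ ↦ ?_
  ring

/-- The affine function `c₀ + c₁ (x - a)`. -/
noncomputable def affineMap (a b : ℝ) (c₀ c₁ : ℂ) : C(Set.Icc a b, ℂ) :=
  c₀ • (1 : C(Set.Icc a b, ℂ)) + c₁ • (⟨fun x ↦ ((x - a : ℝ) : ℂ), by fun_prop⟩ : C(Set.Icc a b, ℂ))

/-- The solution with initial data `c₀`, `c₁` at `a`, as a continuous function. -/
noncomputable def sturmSol (hq : IntervalIntegrable q volume a b) (z c₀ c₁ : ℂ) :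
    C(Set.Icc a b, ℂ) :=
  Ring.inverse (1 - sturmOp hab hq z) (affineMap a b c₀ c₁)

/-- `Ring.inverse` is a genuine inverse here because 1 minus the twofold integration operator is
always a unit; this gives existence and uniqueness together. -/
theorem eq_sturmSol_iff (hq : IntervalIntegrable q volume a b) {z c₀ c₁ : ℂ}
    {y : C(Set.Icc a b, ℂ)} :
    y = sturmSol hab hq z c₀ c₁ ↔ y - sturmOp hab hq z y = affineMap a b c₀ c₁ := by
  have hu : IsUnit (1 - sturmOp hab hq z) :=
    isUnit_one_sub_volterra_comp hab (intervalIntegrable_ofReal_sub_const hq z)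
  constructor
  · rintro rfl
    exact congrArg (· (affineMap a b c₀ c₁)) (Ring.mul_inverse_cancel _ hu)
  · intro h
    rw [sturmSol, ← h]
    exact (congrArg (· y) (Ring.inverse_mul_cancel _ hu)).symm

/-- Inversion is analytic on units, and the operator being inverted is affine in `z`. The initial
data may depend on `z`, as they must when one piece is continued across the origin. -/
theorem differentiable_sturmSol (hq : IntervalIntegrable q volume a b) {c₀ c₁ : ℂ → ℂ}
    (h₀ : Differentiable ℂ c₀) (h₁ : Differentiable ℂ c₁) :
    Differentiable ℂ fun z ↦ sturmSol hab hq z (c₀ z) (c₁ z) := by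
  have hT : Differentiable ℂ fun z ↦ 1 - sturmOp hab hq z := by
    simp only [sturmOp, volterra_ofReal_sub_const hab hq]
    exact differentiable_one_sub_comp_sub_smul _ _ _
  have hg : Differentiable ℂ fun z ↦ affineMap a b (c₀ z) (c₁ z) := by
    simp only [affineMap]
    fun_prop
  exact (hT.inverse fun z ↦
    isUnit_one_sub_volterra_comp hab (intervalIntegrable_ofReal_sub_const hq z)).clm_apply hg

/-- Existence of solutions, with values at the right endpoint that depend analytically on the
spectral parameter. -/
theorem exists_solvesOn {a b : ℝ} (hab : a ≤ b) {q : ℝ → ℝ} (hq : IntervalIntegrable q volume a b) {c₀ c₁ : ℂ → ℂ}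
    (h₀ : Differentiable ℂ c₀) (h₁ : Differentiable ℂ c₁) :
    ∃ y dy : ℂ → ℝ → ℂ, (∀ z, SolvesOn q z a b (y z) (dy z)) ∧ (∀ z, y z a = c₀ z) ∧
      (∀ z, dy z a = c₁ z) ∧ Differentiable ℂ (fun z ↦ y z b) ∧
      Differentiable ℂ (fun z ↦ dy z b) := by
  set Y : ℂ → C(Set.Icc a b, ℂ) := fun z ↦ sturmSol hab hq z (c₀ z) (c₁ z) with hY
  have hYd : Differentiable ℂ Y := differentiable_sturmSol hab hq h₀ h₁
  set DY : ℂ → C(Set.Icc a b, ℂ) := fun z ↦ c₁ z • (1 : C(Set.Icc a b, ℂ)) +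
    volterra hab (intervalIntegrable_ofReal_sub_const hq z) (Y z) with hDY
  have hDYd : Differentiable ℂ DY := by
    simp only [hDY, volterra_ofReal_sub_const hab hq]
    exact (h₁.smul_const _).add (Differentiable.clm_apply (differentiable_sub_smul _ _) hYd)
  have hDYx : ∀ z (x : Set.Icc a b), DY z x = c₁ z +
      ∫ t in a..x, ((q t : ℂ) - z) * Set.IccExtend hab (Y z) t := by
    intro z x
    simp [hDY, volterra_apply]
  have hYx : ∀ z (x : Set.Icc a b), Y z x = c₀ z + ∫ t in a..x, Set.IccExtend hab (DY z) t := by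
    intro z x
    have h := (eq_sturmSol_iff hab hq).1 (show Y z = _ from rfl)
    have h := congrArg (· x) h
    have e : sturmOp hab hq z (Y z) x = ∫ s in a..x, 1 * Set.IccExtend hab
      (volterra hab (intervalIntegrable_ofReal_sub_const hq z) (Y z)) s := rfl
    simp only [ContinuousMap.sub_apply, e, affineMap, ContinuousMap.add_apply,
      ContinuousMap.smul_apply, ContinuousMap.one_apply, ContinuousMap.coe_mk, smul_eq_mul,
      one_mul, mul_one] at h
    have e2 : ∀ s, Set.IccExtend hab (DY z) s = c₁ z + Set.IccExtend hab
      (volterra hab (intervalIntegrable_ofReal_sub_const hq z) (Y z)) s := by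
      intro s
      simp [Set.IccExtend, hDY]
    simp only [e2]
    rw [intervalIntegral.integral_add intervalIntegrable_const
      (((volterra hab _ (Y z)).continuous.Icc_extend' (h := hab)).intervalIntegrable _ _),
      intervalIntegral.integral_const, Complex.real_smul]
    linear_combination h
  have ha : a ∈ Set.Icc a b := ⟨le_rfl, hab⟩
  have hb : b ∈ Set.Icc a b := ⟨hab, le_rfl⟩
  have hYa : ∀ z, Set.IccExtend hab (Y z) a = c₀ z := fun z ↦ by
    rw [Set.IccExtend_of_mem hab _ ha, hYx]; simp
  have hDYa : ∀ z, Set.IccExtend hab (DY z) a = c₁ z := fun z ↦ by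
    rw [Set.IccExtend_of_mem hab _ ha, hDYx]; simp
  refine ⟨fun z ↦ Set.IccExtend hab (Y z), fun z ↦ Set.IccExtend hab (DY z), fun z ↦
    ⟨((Y z).continuous.Icc_extend' (h := hab)).continuousOn,
      ((DY z).continuous.Icc_extend' (h := hab)).continuousOn, fun x hx ↦ ?_, fun x hx ↦ ?_⟩,
      hYa, hDYa, ?_, ?_⟩
  · beta_reduce
    rw [hYa, Set.IccExtend_of_mem hab _ hx, hYx]
  · beta_reduce
    rw [hDYa, Set.IccExtend_of_mem hab _ hx, hDYx]
  · simp only [Set.IccExtend_of_mem hab _ hb]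
    exact (ContinuousMap.evalCLM ℂ (⟨b, hb⟩ : Set.Icc a b)).differentiable.comp hYd
  · simp only [Set.IccExtend_of_mem hab _ hb]
    exact (ContinuousMap.evalCLM ℂ (⟨b, hb⟩ : Set.Icc a b)).differentiable.comp hDYd

/-- Substituting the integral equation for `dy` into the one for `y` gives the fixed-point equation,
whose solution is unique. -/
theorem SolvesOn.restrict_eq_sturmSol (hq : IntervalIntegrable q volume a b) {z : ℂ}
    {y dy : ℝ → ℂ} (h : SolvesOn q z a b y dy) :
    (⟨fun x : Set.Icc a b ↦ y x, h.1.comp_continuous continuous_subtype_val fun x ↦ x.2⟩ : C(Set.Icc a b, ℂ)) =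
      sturmSol hab hq z (y a) (dy a) := by
  obtain ⟨hy, hdy, ey, edy⟩ := h
  rw [eq_sturmSol_iff]
  set Y : C(Set.Icc a b, ℂ) := ⟨fun x : Set.Icc a b ↦ y x, hy.comp_continuous continuous_subtype_val fun x ↦ x.2⟩ with hY
  ext x
  have e : sturmOp hab hq z Y x = ∫ s in a..x, 1 * Set.IccExtend hab
      (volterra hab (intervalIntegrable_ofReal_sub_const hq z) Y) s := rfl
  have e2 : ∀ s ∈ Set.Icc a b, Set.IccExtend hab
      (volterra hab (intervalIntegrable_ofReal_sub_const hq z) Y) s = dy s - dy a := by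
    intro s hs
    rw [Set.IccExtend_of_mem hab _ hs, volterra_apply, edy s hs, add_sub_cancel_left]
    refine intervalIntegral.integral_congr fun t ht ↦ ?_
    rw [Set.uIcc_of_le hs.1] at ht
    rw [Set.IccExtend_of_mem hab _ ⟨ht.1, ht.2.trans hs.2⟩]
    rfl
  have e3 : (∫ s in a..(x : ℝ), 1 * Set.IccExtend hab
      (volterra hab (intervalIntegrable_ofReal_sub_const hq z) Y) s) =
      ∫ s in a..(x : ℝ), (dy s - dy a) := by
    refine intervalIntegral.integral_congr fun t ht ↦ ?_
    rw [Set.uIcc_of_le x.2.1] at ht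
    rw [one_mul, e2 t ⟨ht.1, ht.2.trans x.2.2⟩]
  have hdi : IntervalIntegrable dy volume a x :=
    (hdy.mono (by rw [Set.uIcc_of_le x.2.1]
                  exact Set.Icc_subset_Icc_right x.2.2)).intervalIntegrable
  rw [ContinuousMap.sub_apply, e, e3, intervalIntegral.integral_sub hdi intervalIntegrable_const,
    intervalIntegral.integral_const, Complex.real_smul]
  simp only [hY, affineMap, ContinuousMap.add_apply, ContinuousMap.smul_apply,
    ContinuousMap.one_apply, ContinuousMap.coe_mk, smul_eq_mul, mul_one]
  rw [ey x x.2]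
  ring

/-- Solutions are determined by their initial data. -/
theorem SolvesOn.unique {a b : ℝ} (hab : a ≤ b) {q : ℝ → ℝ}
    (hq : IntervalIntegrable q volume a b) {z : ℂ}
    {y dy y' dy' : ℝ → ℂ} (h : SolvesOn q z a b y dy) (h' : SolvesOn q z a b y' dy')
    (e₀ : y a = y' a) (e₁ : dy a = dy' a) : ∀ x ∈ Set.Icc a b, y x = y' x ∧ dy x = dy' x := by
  have key : ∀ x ∈ Set.Icc a b, y x = y' x := by
    intro x hx
    have e : sturmSol hab hq z (y a) (dy a) = sturmSol hab hq z (y' a) (dy' a) := by rw [e₀, e₁]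
    exact congrArg (· ⟨x, hx⟩) ((h.restrict_eq_sturmSol hab hq).trans
      (e.trans (h'.restrict_eq_sturmSol hab hq).symm))
  refine fun x hx ↦ ⟨key x hx, ?_⟩
  rw [h.2.2.2 x hx, h'.2.2.2 x hx, e₁]
  congr 1
  refine intervalIntegral.integral_congr fun t ht ↦ ?_
  rw [Set.uIcc_of_le hx.1] at ht
  rw [key t ⟨ht.1, ht.2.trans hx.2⟩]

end Volterra

/-! ### Lagrange's identity and the energy identity -/

open ComplexConjugate

theorem intervalIntegral_conj (f : ℝ → ℂ) (a b : ℝ) :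
    ∫ t in a..b, conj (f t) = conj (∫ t in a..b, f t) := by
  simp only [intervalIntegral, integral_conj, map_sub]

namespace SolvesOn

variable {q : ℝ → ℝ} {z ζ : ℂ} {a b : ℝ} {y dy v dv : ℝ → ℂ}

theorem intervalIntegrable_dy (hab : a ≤ b) (h : SolvesOn q z a b y dy) :
    IntervalIntegrable dy volume a b :=
  (h.2.1.mono (by rw [Set.uIcc_of_le hab])).intervalIntegrable

theorem intervalIntegrable_y (hab : a ≤ b) (h : SolvesOn q z a b y dy) :
    IntervalIntegrable y volume a b :=
  (h.1.mono (by rw [Set.uIcc_of_le hab])).intervalIntegrable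

theorem intervalIntegrable_coeff (hab : a ≤ b) (hq : IntervalIntegrable q volume a b)
    (h : SolvesOn q z a b y dy) :
    IntervalIntegrable (fun t ↦ ((q t : ℂ) - z) * y t) volume a b :=
  (intervalIntegrable_ofReal_sub_const hq z).mul_continuousOn
    (h.1.mono (by rw [Set.uIcc_of_le hab]))

theorem linear_comb (hab : a ≤ b) (hq : IntervalIntegrable q volume a b)
    (h : SolvesOn q z a b y dy) (h' : SolvesOn q z a b v dv) (c d : ℂ) :
    SolvesOn q z a b (fun x ↦ c * y x + d * v x) (fun x ↦ c * dy x + d * dv x) := by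
  refine ⟨(h.1.const_smul c).add (h'.1.const_smul d),
    (h.2.1.const_smul c).add (h'.2.1.const_smul d), fun x hx ↦ ?_, fun x hx ↦ ?_⟩
  · have i := intervalIntegrable_left_of_mem (h.intervalIntegrable_dy hab) hx
    have i' := intervalIntegrable_left_of_mem (h'.intervalIntegrable_dy hab) hx
    rw [intervalIntegral.integral_add (i.const_mul c) (i'.const_mul d),
      intervalIntegral.integral_const_mul, intervalIntegral.integral_const_mul]
    linear_combination c * h.2.2.1 x hx + d * h'.2.2.1 x hx
  · have i := intervalIntegrable_left_of_mem (h.intervalIntegrable_coeff hab hq) hx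
    have i' := intervalIntegrable_left_of_mem (h'.intervalIntegrable_coeff hab hq) hx
    have e : (fun t ↦ ((q t : ℂ) - z) * (c * y t + d * v t)) =
        fun t ↦ c * (((q t : ℂ) - z) * y t) + d * (((q t : ℂ) - z) * v t) := by
      ext t; ring
    rw [e, intervalIntegral.integral_add (i.const_mul c) (i'.const_mul d),
      intervalIntegral.integral_const_mul, intervalIntegral.integral_const_mul]
    linear_combination c * h.2.2.2 x hx + d * h'.2.2.2 x hx

theorem conjugate (h : SolvesOn q z a b y dy) :
    SolvesOn q (conj z) a b (fun x ↦ conj (y x)) (fun x ↦ conj (dy x)) := by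
  refine ⟨Complex.continuous_conj.comp_continuousOn h.1,
    Complex.continuous_conj.comp_continuousOn h.2.1, fun x hx ↦ ?_, fun x hx ↦ ?_⟩
  · rw [intervalIntegral_conj, ← map_add, ← h.2.2.1 x hx]
  · have e : (fun t ↦ ((q t : ℂ) - (starRingEnd ℂ) z) * (starRingEnd ℂ) (y t)) =
        fun t ↦ (starRingEnd ℂ) (((q t : ℂ) - z) * y t) := by
      ext t; simp
    rw [e, intervalIntegral_conj, ← map_add, ← h.2.2.2 x hx]

/-- Lagrange's identity. -/
theorem lagrange (hab : a ≤ b) (hq : IntervalIntegrable q volume a b)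
    (h : SolvesOn q z a b y dy) (h' : SolvesOn q ζ a b v dv) :
    (dy b * v b - y b * dv b) - (dy a * v a - y a * dv a) = (ζ - z) * ∫ t in a..b, y t * v t := by
  have hyc : ContinuousOn y (Set.uIcc a b) := h.1.mono (by rw [Set.uIcc_of_le hab])
  have hvc : ContinuousOn v (Set.uIcc a b) := h'.1.mono (by rw [Set.uIcc_of_le hab])
  have hdyc : ContinuousOn dy (Set.uIcc a b) := h.2.1.mono (by rw [Set.uIcc_of_le hab])
  have hdvc : ContinuousOn dv (Set.uIcc a b) := h'.2.1.mono (by rw [Set.uIcc_of_le hab])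
  have iy := h.intervalIntegrable_coeff hab hq
  have iv := h'.intervalIntegrable_coeff hab hq
  have idy := h.intervalIntegrable_dy hab
  have idv := h'.intervalIntegrable_dy hab
  have p1 := mul_sub_mul_eq_integral_of_primitive hab iy idv h.2.2.2 h'.2.2.1
  have p2 := mul_sub_mul_eq_integral_of_primitive hab idy iv h.2.2.1 h'.2.2.2
  have e : (∫ t in a..b, (((q t : ℂ) - z) * y t * v t + dy t * dv t)) -
      (∫ t in a..b, (dy t * dv t + y t * (((q t : ℂ) - ζ) * v t))) =
      (ζ - z) * ∫ t in a..b, y t * v t := by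
    rw [← intervalIntegral.integral_sub
      ((iy.mul_continuousOn hvc).add (idv.continuousOn_mul hdyc))
      ((idy.mul_continuousOn hdvc).add (iv.continuousOn_mul hyc)),
      ← intervalIntegral.integral_const_mul]
    refine intervalIntegral.integral_congr fun t _ ↦ ?_
    ring
  rw [← e, ← p1, ← p2]
  ring

/-- This is Lagrange's identity for `y` and its conjugate, which solves the equation with parameter
conj z since `q` is real. -/
theorem im_mul_conj_sub (hab : a ≤ b) (hq : IntervalIntegrable q volume a b)
    (h : SolvesOn q z a b y dy) :
    (dy b * (starRingEnd ℂ) (y b)).im - (dy a * (starRingEnd ℂ) (y a)).im =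
      -(z.im * ∫ t in a..b, ‖y t‖ ^ 2) := by
  have e := h.lagrange hab hq h.conjugate
  have e2 : (∫ t in a..b, y t * (starRingEnd ℂ) (y t)) = ((∫ t in a..b, ‖y t‖ ^ 2 : ℝ) : ℂ) := by
    rw [← intervalIntegral.integral_ofReal]
    refine intervalIntegral.integral_congr fun t _ ↦ ?_
    rw [Complex.mul_conj, Complex.normSq_eq_norm_sq]
  rw [e2] at e
  have e3 := congrArg Complex.im e
  simp at e3 ⊢
  linarith

theorem integral_norm_sq_nonneg (hab : a ≤ b) (y : ℝ → ℂ) : 0 ≤ ∫ t in a..b, ‖y t‖ ^ 2 :=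
  intervalIntegral.integral_nonneg hab fun _ _ ↦ by positivity

/-- If the integral vanished, `y` would be zero throughout, hence `dy` constant, and y(b) = y(a) +
(b - a) dy(a) would force both initial values to vanish. -/
theorem integral_norm_sq_pos (hab : a < b) (h : SolvesOn q z a b y dy)
    (h0 : y a ≠ 0 ∨ dy a ≠ 0) : 0 < ∫ t in a..b, ‖y t‖ ^ 2 := by
  have hc : ContinuousOn (fun t ↦ ‖y t‖ ^ 2) (Set.Icc a b) := h.1.norm.pow 2
  refine intervalIntegral.integral_pos hab hc (fun _ _ ↦ by positivity) ?_
  by_contra! hall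
  have hz : ∀ x ∈ Set.Icc a b, y x = 0 := fun x hx ↦ by
    have := hall x hx
    have h2 : ‖y x‖ = 0 := by
      nlinarith [norm_nonneg (y x), sq_nonneg ‖y x‖]
    exact norm_eq_zero.1 h2
  have ha : a ∈ Set.Icc a b := ⟨le_rfl, hab.le⟩
  rcases h0 with h0 | h0
  · exact h0 (hz a ha)
  · have hdc : ∀ x ∈ Set.Icc a b, dy x = dy a := by
      intro x hx
      rw [h.2.2.2 x hx, add_eq_left]
      refine (intervalIntegral.integral_congr (g := fun _ ↦ (0 : ℂ)) fun t ht ↦ ?_).trans (by simp)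
      rw [Set.uIcc_of_le hx.1] at ht
      simp [hz t ⟨ht.1, ht.2.trans hx.2⟩]
    have e := h.2.2.1 b ⟨hab.le, le_rfl⟩
    rw [hz a ha, hz b ⟨hab.le, le_rfl⟩, zero_add,
      intervalIntegral.integral_congr (g := fun _ ↦ dy a) (fun t ht ↦ by
        rw [Set.uIcc_of_le hab.le] at ht; exact hdc t ht), intervalIntegral.integral_const,
      Complex.real_smul] at e
    rcases mul_eq_zero.1 e.symm with h1 | h1
    · rw [Complex.ofReal_eq_zero] at h1; linarith
    · exact h0 h1

end SolvesOn

/-! ### Solutions across the origin and the terminal pair -/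

namespace TransferProblem

variable (P : TransferProblem)

theorem q_integrableOn : IntegrableOn P.q (Set.Icc (-P.S) P.S) :=
  P.q_memLp.integrable (by norm_num)

theorem q_left : IntervalIntegrable P.q volume (-P.S) 0 := by
  have := P.S_pos
  rw [intervalIntegrable_iff_integrableOn_Icc_of_le (by linarith)]
  exact P.q_integrableOn.mono_set (Set.Icc_subset_Icc_right this.le)

theorem q_right : IntervalIntegrable P.q volume 0 P.S := by
  have := P.S_pos
  rw [intervalIntegrable_iff_integrableOn_Icc_of_le (by linarith)]
  exact P.q_integrableOn.mono_set (Set.Icc_subset_Icc_left (by linarith))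

theorem left_le : -P.S ≤ 0 := by linarith [P.S_pos]

theorem det_eq : P.M.det = P.M 0 0 * P.M 1 1 - P.M 0 1 * P.M 1 0 := Matrix.det_fin_two _

/-- The left piece ends at the origin with entire values, and `M` maps these to entire initial data
for the right piece. -/
theorem exists_isSolution_entire {c₀ c₁ : ℂ → ℂ} (h₀ : Differentiable ℂ c₀)
    (h₁ : Differentiable ℂ c₁) : ∃ Y : ℂ → TwoSided, (∀ z, P.IsSolution z (Y z)) ∧
      (∀ z, (Y z).left (-P.S) = c₀ z) ∧ (∀ z, (Y z).dleft (-P.S) = c₁ z) ∧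
      Differentiable ℂ (fun z ↦ (Y z).right P.S) ∧ Differentiable ℂ (fun z ↦ (Y z).dright P.S) := by
  obtain ⟨l, dl, hl, l0, l1, dl0, dl1⟩ := exists_solvesOn P.left_le P.q_left h₀ h₁
  obtain ⟨r, dr, hr, r0, r1, dr0, dr1⟩ := exists_solvesOn P.S_pos.le P.q_right
    (c₀ := fun z ↦ (P.M 0 0 : ℂ) * l z 0 + (P.M 0 1 : ℂ) * dl z 0)
    (c₁ := fun z ↦ (P.M 1 0 : ℂ) * l z 0 + (P.M 1 1 : ℂ) * dl z 0)
    ((dl0.const_mul _).add (dl1.const_mul _)) ((dl0.const_mul _).add (dl1.const_mul _))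
  exact ⟨fun z ↦ ⟨l z, dl z, r z, dr z⟩, fun z ↦ ⟨hl z, hr z, r0 z, r1 z⟩, l0, l1, dr0, dr1⟩

theorem exists_isSolution (z c₀ c₁ : ℂ) : ∃ y : TwoSided, P.IsSolution z y ∧
    y.left (-P.S) = c₀ ∧ y.dleft (-P.S) = c₁ := by
  obtain ⟨Y, h, h0, h1, -⟩ := P.exists_isSolution_entire (differentiable_const c₀)
    (differentiable_const c₁)
  exact ⟨Y z, h z, h0 z, h1 z⟩

variable {P}

theorem IsSolution.unique {z : ℂ} {y v : TwoSided} (h : P.IsSolution z y) (h' : P.IsSolution z v)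
    (e₀ : y.left (-P.S) = v.left (-P.S)) (e₁ : y.dleft (-P.S) = v.dleft (-P.S)) :
    (∀ x ∈ Set.Icc (-P.S) 0, y.left x = v.left x ∧ y.dleft x = v.dleft x) ∧
      (∀ x ∈ Set.Icc 0 P.S, y.right x = v.right x ∧ y.dright x = v.dright x) := by
  have hl := h.left_eq.unique P.left_le P.q_left h'.left_eq e₀ e₁
  refine ⟨hl, h.right_eq.unique P.S_pos.le P.q_right h'.right_eq ?_ ?_⟩
  · have := hl 0 ⟨P.left_le, le_rfl⟩
    rw [h.transfer, h'.transfer, this.1, this.2]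
  · have := hl 0 ⟨P.left_le, le_rfl⟩
    rw [h.dtransfer, h'.dtransfer, this.1, this.2]

theorem IsSolution.linear_comb {z : ℂ} {y v : TwoSided} (h : P.IsSolution z y)
    (h' : P.IsSolution z v) (c d : ℂ) : P.IsSolution z
      ⟨fun x ↦ c * y.left x + d * v.left x, fun x ↦ c * y.dleft x + d * v.dleft x,
        fun x ↦ c * y.right x + d * v.right x, fun x ↦ c * y.dright x + d * v.dright x⟩ where
  left_eq := h.left_eq.linear_comb P.left_le P.q_left h'.left_eq c d
  right_eq := h.right_eq.linear_comb P.S_pos.le P.q_right h'.right_eq c d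
  transfer := by simp only; rw [h.transfer, h'.transfer]; ring
  dtransfer := by simp only; rw [h.dtransfer, h'.dtransfer]; ring

/-- The Wronskian is constant on each side, and the transfer condition multiplies it by det M. -/
theorem IsSolution.wronskian {z : ℂ} {y v : TwoSided} (h : P.IsSolution z y)
    (h' : P.IsSolution z v) :
    y.dright P.S * v.right P.S - y.right P.S * v.dright P.S = (P.M.det : ℂ) *
      (y.dleft (-P.S) * v.left (-P.S) - y.left (-P.S) * v.dleft (-P.S)) := by
  have e1 := h.left_eq.lagrange P.left_le P.q_left h'.left_eq
  have e2 := h.right_eq.lagrange P.S_pos.le P.q_right h'.right_eq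
  rw [h.transfer, h.dtransfer, h'.transfer, h'.dtransfer] at e2
  rw [P.det_eq]
  push_cast
  linear_combination e2 + ((P.M 0 0 : ℂ) * P.M 1 1 - P.M 0 1 * P.M 1 0) * e1

/-- `(a, b)` are the values at `-S` of `(ψ, ψ')`, where `ψ` is an entire family of solutions that
obey the terminal condition with angle `β`. The condition is expressed through the terminal values
of all solutions. -/
structure IsTerminalPair (P : TransferProblem) (β : ℝ) (a b : ℂ → ℂ) : Prop where
  diff_fst : Differentiable ℂ a
  diff_snd : Differentiable ℂ b
  terminal : ∀ z y, P.IsSolution z y →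
    y.right P.S * (Real.cos β : ℂ) - y.dright P.S * (Real.sin β : ℂ) =
      a z * y.dleft (-P.S) - b z * y.left (-P.S)
  ne_zero : ∀ z, a z ≠ 0 ∨ b z ≠ 0

theorem exists_isTerminalPair (P : TransferProblem) (β : ℝ) : ∃ a b, P.IsTerminalPair β a b := by
  obtain ⟨C, hC, C0, C1, dC0, dC1⟩ := P.exists_isSolution_entire (differentiable_const 1)
    (differentiable_const 0)
  obtain ⟨T, hT, T0, T1, dT0, dT1⟩ := P.exists_isSolution_entire (differentiable_const 0)
    (differentiable_const 1)
  -- The terminal functional is linear in the initial data, so it is determined by its values on the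
  -- basis `C`, `T`; these values, with one sign changed, are the pair.
  refine ⟨fun z ↦ (T z).right P.S * (Real.cos β : ℂ) - (T z).dright P.S * (Real.sin β : ℂ),
    fun z ↦ -((C z).right P.S * (Real.cos β : ℂ) - (C z).dright P.S * (Real.sin β : ℂ)),
    (dT0.mul_const _).sub (dT1.mul_const _), ((dC0.mul_const _).sub (dC1.mul_const _)).neg, ?_, ?_⟩
  · intro z y hy
    have := (hy.unique ((hC z).linear_comb (hT z) (y.left (-P.S)) (y.dleft (-P.S)))
      (by simp [C0, T0]) (by simp [C1, T1])).2 P.S ⟨P.S_pos.le, le_rfl⟩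
    rw [this.1, this.2]
    ring
  · intro z
    by_contra! h
    obtain ⟨h1, h2⟩ := h
    have w := (hC z).wronskian (hT z)
    rw [C0, C1, T0, T1] at w
    have hd : (P.M.det : ℂ) ≠ 0 := by exact_mod_cast P.det_pos.ne'
    have hcs : (Real.cos β : ℂ) ^ 2 + (Real.sin β : ℂ) ^ 2 = 1 := by
      exact_mod_cast Real.cos_sq_add_sin_sq β
    -- If both basis solutions obeyed the terminal condition, their Wronskian at `S` would vanish,
    -- contradicting det M ≠ 0.
    have k1 : (P.M.det : ℂ) * Real.cos β = 0 := by
      linear_combination (Real.cos β : ℂ) * w - (C z).dright P.S * h1 - (T z).dright P.S * h2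
    have k2 : (P.M.det : ℂ) * Real.sin β = 0 := by
      linear_combination (Real.sin β : ℂ) * w - (C z).right P.S * h1 - (T z).right P.S * h2
    apply hd
    linear_combination (-(P.M.det : ℂ)) * hcs + Real.cos β * k1 + Real.sin β * k2

namespace IsTerminalPair

variable {α β : ℝ} {a b : ℂ → ℂ}

/-- Im(ψ' conj ψ) vanishes at `S` by the real boundary condition, is multiplied by det M at the
origin, and otherwise changes by the energy integrals. -/
theorem im_mul_conj (h : P.IsTerminalPair β a b) {z : ℂ} {ψ : TwoSided} (hψ : P.IsSolution z ψ)
    (e₀ : ψ.left (-P.S) = a z) (e₁ : ψ.dleft (-P.S) = b z) :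
    (b z * conj (a z)).im = z.im * ((∫ t in (-P.S)..0, ‖ψ.left t‖ ^ 2) +
      P.M.det⁻¹ * ∫ t in 0..P.S, ‖ψ.right t‖ ^ 2) := by
  have ht := h.terminal z ψ hψ
  rw [e₀, e₁, mul_comm (b z), sub_self] at ht
  have i1 := hψ.left_eq.im_mul_conj_sub P.left_le P.q_left
  have i2 := hψ.right_eq.im_mul_conj_sub P.S_pos.le P.q_right
  have hS : (ψ.dright P.S * conj (ψ.right P.S)).im = 0 := by
    have r := congrArg Complex.re ht
    have i := congrArg Complex.im ht
    simp [-Complex.ofReal_cos, -Complex.ofReal_sin] at r i ⊢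
    have hcs := Real.cos_sq_add_sin_sq β
    generalize Real.cos β = c at *
    generalize Real.sin β = s at *
    -- Multiplying by cos β and by sin β separately and using cos² + sin² = 1 avoids a case split on
    -- which of them vanishes.
    have k1 : c * (-((ψ.dright P.S).re * (ψ.right P.S).im) +
      (ψ.dright P.S).im * (ψ.right P.S).re) = 0 := by
      linear_combination (ψ.dright P.S).im * r - (ψ.dright P.S).re * i
    have k2 : s * (-((ψ.dright P.S).re * (ψ.right P.S).im) +
      (ψ.dright P.S).im * (ψ.right P.S).re) = 0 := by
      linear_combination (ψ.right P.S).im * r - (ψ.right P.S).re * i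
    have : (c ^ 2 + s ^ 2) * (-((ψ.dright P.S).re * (ψ.right P.S).im) +
      (ψ.dright P.S).im * (ψ.right P.S).re) = 0 := by
      linear_combination c * k1 + s * k2
    rwa [hcs, one_mul] at this
  have h0 : (ψ.dright 0 * conj (ψ.right 0)).im = P.M.det * (ψ.dleft 0 * conj (ψ.left 0)).im := by
    rw [hψ.transfer, hψ.dtransfer, P.det_eq]
    simp
    ring
  rw [hS, h0] at i2
  rw [e₀, e₁] at i1
  have hd := P.det_pos.ne'
  have : (ψ.dleft 0 * conj (ψ.left 0)).im = z.im * (P.M.det⁻¹ * ∫ t in 0..P.S, ‖ψ.right t‖ ^ 2) := by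
    field_simp
    linarith
  rw [this] at i1
  linear_combination -i1

theorem im_mul_conj_eq (h : P.IsTerminalPair β a b) (z : ℂ) :
    ∃ p > 0, (b z * conj (a z)).im = z.im * p := by
  obtain ⟨ψ, hψ, e₀, e₁⟩ := P.exists_isSolution z (a z) (b z)
  refine ⟨_, ?_, h.im_mul_conj hψ e₀ e₁⟩
  have h1 := hψ.left_eq.integral_norm_sq_pos (by linarith [P.S_pos]) (by
    rw [e₀, e₁]; exact h.ne_zero z)
  have h2 := SolvesOn.integral_norm_sq_nonneg P.S_pos.le ψ.right
  have h3 := inv_pos.2 P.det_pos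
  positivity

/-- Since det M > 0, the energy of the right half can be dropped, leaving a bound that involves only
[-S, 0]. -/
theorem integral_le (h : P.IsTerminalPair β a b) {z : ℂ} {ψ : TwoSided} (hψ : P.IsSolution z ψ)
    (e₀ : ψ.left (-P.S) = a z) (e₁ : ψ.dleft (-P.S) = b z) (hz : 0 < z.im) :
    z.im * (∫ t in (-P.S)..0, ‖ψ.left t‖ ^ 2) ≤ (b z * conj (a z)).im := by
  rw [h.im_mul_conj hψ e₀ e₁]
  have h2 := SolvesOn.integral_norm_sq_nonneg P.S_pos.le ψ.right
  have h3 := inv_pos.2 P.det_pos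
  refine mul_le_mul_of_nonneg_left ?_ hz.le
  have := mul_nonneg h3.le h2
  linarith

theorem fst_ne_zero (h : P.IsTerminalPair β a b) {z : ℂ} (hz : z.im ≠ 0) : a z ≠ 0 := by
  intro h0
  obtain ⟨p, hp, e⟩ := h.im_mul_conj_eq z
  simp [h0, hz, hp.ne'] at e

/-- The two boundary conditions form a linear system in the initial data of `y`, and this expression
is its determinant up to sign. -/
theorem isEigenvalue_iff (h : P.IsTerminalPair β a b) (α : ℝ) (z : ℂ) :
    P.IsEigenvalue α β z ↔ a z * Real.cos α - b z * Real.sin α = 0 := by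
  have hcs : (Real.cos α : ℂ) ^ 2 + (Real.sin α : ℂ) ^ 2 = 1 := by
    exact_mod_cast Real.cos_sq_add_sin_sq α
  constructor
  · rintro ⟨y, hy, i, t, ne⟩
    rw [h.terminal z y hy] at t
    by_contra hA
    have k0 : y.left (-P.S) = 0 := by
      have : y.left (-P.S) * (a z * Real.cos α - b z * Real.sin α) = 0 := by
        linear_combination Real.sin α * t + a z * i
      exact (mul_eq_zero.1 this).resolve_right hA
    have k1 : y.dleft (-P.S) = 0 := by
      have : y.dleft (-P.S) * (a z * Real.cos α - b z * Real.sin α) = 0 := by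
        linear_combination Real.cos α * t + b z * i
      exact (mul_eq_zero.1 this).resolve_right hA
    have u := hy.unique (hy.linear_comb hy 0 0) (by simp [k0]) (by simp [k1])
    rcases ne with ⟨x, hx, hne⟩ | ⟨x, hx, hne⟩
    · exact hne (by simpa using (u.1 x hx).1)
    · exact hne (by simpa using (u.2 x hx).1)
  · intro hA
    obtain ⟨y, hy, e₀, e₁⟩ := P.exists_isSolution z (Real.sin α) (Real.cos α)
    refine ⟨y, hy, by rw [e₀, e₁]; ring, by rw [h.terminal z y hy, e₀, e₁, hA], Or.inl ?_⟩
    have hp := hy.left_eq.integral_norm_sq_pos (by linarith [P.S_pos]) (by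
      rw [e₀, e₁]
      by_contra! hc
      rw [hc.1, hc.2] at hcs
      norm_num at hcs)
    by_contra! hall
    refine hp.ne' ((intervalIntegral.integral_congr (g := fun _ ↦ (0 : ℝ)) fun t ht ↦ ?_).trans
      (by simp))
    rw [Set.uIcc_of_le P.left_le] at ht
    simp [hall t ht]

theorem isWeylValue_iff (h : P.IsTerminalPair β a b) (α : ℝ) (z m : ℂ) :
    P.IsWeylValue α β z m ↔ m * (a z * Real.cos α - b z * Real.sin α) =
      a z * Real.sin α + b z * Real.cos α := by
  constructor
  · rintro ⟨u, w, hu, hw, u0, u1, w0, w1, e⟩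
    have tu := h.terminal z u hu
    have tw := h.terminal z w hw
    rw [u0, u1] at tu
    rw [w0, w1] at tw
    linear_combination e - tu - m * tw
  · intro e
    obtain ⟨u, hu, u0, u1⟩ := P.exists_isSolution z (Real.cos α) (-Real.sin α)
    obtain ⟨w, hw, w0, w1⟩ := P.exists_isSolution z (Real.sin α) (Real.cos α)
    have tu := h.terminal z u hu
    have tw := h.terminal z w hw
    rw [u0, u1] at tu
    rw [w0, w1] at tw
    refine ⟨u, w, hu, hw, u0, u1, w0, w1, ?_⟩
    linear_combination e + tu + m * tw

end IsTerminalPair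

end TransferProblem

/-! ### Asymptotics of the m-function along the imaginary axis -/

theorem sq_integral_mul_le {X : Type*} [MeasurableSpace X] {μ : Measure X} {f g : X → ℝ}
    (hf : MemLp f 2 μ) (hg : MemLp g 2 μ) :
    (∫ x, f x * g x ∂μ) ^ 2 ≤ (∫ x, f x ^ 2 ∂μ) * ∫ x, g x ^ 2 ∂μ := by
  have i1 := hf.integrable_sq
  have i2 := hg.integrable_sq
  have i3 : Integrable (fun x ↦ f x * g x) μ := hf.integrable_mul hg
  have key : ∀ s : ℝ, 0 ≤ (∫ x, g x ^ 2 ∂μ) * (s * s) + (2 * ∫ x, f x * g x ∂μ) * s +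
      ∫ x, f x ^ 2 ∂μ := by
    intro s
    have h : 0 ≤ ∫ x, (s * s) * g x ^ 2 + (2 * s) * (f x * g x) + f x ^ 2 ∂μ :=
      integral_nonneg fun x ↦ by
        simp only [Pi.zero_apply]
        nlinarith [sq_nonneg (s * g x + f x)]
    have i4 : Integrable (fun x ↦ (s * s) * g x ^ 2 + (2 * s) * (f x * g x)) μ :=
      (i2.const_mul _).add (i3.const_mul _)
    rw [integral_add i4 i1, integral_add (i2.const_mul _) (i3.const_mul _), integral_const_mul, integral_const_mul] at h
    linarith
  have := discrim_le_zero key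
  rw [discrim] at this
  nlinarith

theorem sq_integral_norm_mul_le {a b : ℝ} (hab : a ≤ b) {y : ℝ → ℂ} {g : ℝ → ℝ}
    (hy : ContinuousOn y (Set.Icc a b)) (hg : MemLp g 2 (volume.restrict (Set.Icc a b))) :
    IntervalIntegrable (fun x ↦ ‖y x‖ * g x) volume a b ∧
    (∫ x in a..b, ‖y x‖ * g x) ^ 2 ≤ (∫ x in a..b, ‖y x‖ ^ 2) * ∫ x in a..b, g x ^ 2 := by
  have hy' : MemLp (fun x ↦ ‖y x‖) 2 (volume.restrict (Set.Icc a b)) := by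
    rw [memLp_two_iff_integrable_sq (hy.norm.aestronglyMeasurable measurableSet_Icc)]
    exact (hy.norm.pow 2).integrableOn_Icc
  constructor
  · rw [intervalIntegrable_iff_integrableOn_Icc_of_le hab]
    exact hy'.integrable_mul hg
  · simp only [intervalIntegral.integral_of_le hab, ← integral_Icc_eq_integral_Ioc]
    exact sq_integral_mul_le hy' hg

namespace SolvesOn

/-- A solution tested against a decaying exponential with a quadratic cutoff. -/
theorem test_identity {q : ℝ → ℝ} {S : ℝ} (hS : 0 < S) (hq : IntervalIntegrable q volume (-S) 0)
    {κ : ℂ} {y dy : ℝ → ℂ} (h : SolvesOn q (-κ ^ 2) (-S) 0 y dy) :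
    dy (-S) - y (-S) * (κ - 2 / S) = -∫ x in (-S)..0, y x * (Complex.exp (κ * (x + S)) *
      (q x * (x / S) ^ 2 - 4 * κ * x / S ^ 2 - 2 / S ^ 2)) := by
  have hab : -S ≤ 0 := by linarith
  have hS' : (S : ℂ) ≠ 0 := by exact_mod_cast hS.ne'
  -- `f1` and `f2` are the first two derivatives of `f`. The double zero at 0 removes the boundary
  -- terms at the origin, and the κ² term of `f2` cancels against the spectral parameter.
  set f : ℝ → ℂ := fun x ↦ Complex.exp (κ * (x + S)) * (x / S) ^ 2 with hf
  set f1 : ℝ → ℂ := fun x ↦ Complex.exp (κ * (x + S)) * (κ * (x / S) ^ 2 + 2 * x / S ^ 2) with hf1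
  set f2 : ℝ → ℂ := fun x ↦ Complex.exp (κ * (x + S)) *
    (κ ^ 2 * (x / S) ^ 2 + 4 * κ * x / S ^ 2 + 2 / S ^ 2) with hf2
  have hid : ∀ x : ℝ, HasDerivAt (fun x : ℝ ↦ (x : ℂ)) 1 x := fun x ↦ Complex.ofRealCLM.hasDerivAt
  have hexp : ∀ x : ℝ, HasDerivAt (fun x : ℝ ↦ Complex.exp (κ * (x + S)))
      (Complex.exp (κ * (x + S)) * κ) x := fun x ↦ by
    have := (((hid x).add_const (S : ℂ)).const_mul κ).cexp
    simpa using this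
  have d1 : ∀ x : ℝ, HasDerivAt f (f1 x) x := fun x ↦ by
    refine ((hexp x).mul (((hid x).div_const (S : ℂ)).pow 2)).congr_deriv ?_
    simp only [hf1, Pi.pow_apply]
    push_cast
    field_simp
  have d2 : ∀ x : ℝ, HasDerivAt f1 (f2 x) x := fun x ↦ by
    refine ((hexp x).mul (((((hid x).div_const (S : ℂ)).pow 2).const_mul κ).add
      (((hid x).const_mul 2).div_const ((S : ℂ) ^ 2)))).congr_deriv ?_
    simp only [hf2, Pi.pow_apply, Pi.add_apply]
    push_cast
    field_simp
    ring
  have c1 : Continuous f1 := by fun_prop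
  have c2 : Continuous f2 := by fun_prop
  have c0 : Continuous f := by fun_prop
  have p1 : ∀ x ∈ Set.Icc (-S) 0, f x = f (-S) + ∫ t in (-S)..x, f1 t := fun x _ ↦ by
    rw [intervalIntegral.integral_eq_sub_of_hasDerivAt (fun t _ ↦ d1 t) (c1.intervalIntegrable _ _)]
    ring
  have p2 : ∀ x ∈ Set.Icc (-S) 0, f1 x = f1 (-S) + ∫ t in (-S)..x, f2 t := fun x _ ↦ by
    rw [intervalIntegral.integral_eq_sub_of_hasDerivAt (fun t _ ↦ d2 t) (c2.intervalIntegrable _ _)]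
    ring
  have iy := h.intervalIntegrable_coeff hab hq
  have idy := h.intervalIntegrable_dy hab
  have hyc : ContinuousOn y (Set.uIcc (-S) 0) := h.1.mono (by rw [Set.uIcc_of_le hab])
  have hdyc : ContinuousOn dy (Set.uIcc (-S) 0) := h.2.1.mono (by rw [Set.uIcc_of_le hab])
  have e1 := mul_sub_mul_eq_integral_of_primitive hab iy (c1.intervalIntegrable _ _) h.2.2.2 p1
  have e2 := mul_sub_mul_eq_integral_of_primitive hab idy (c2.intervalIntegrable _ _) h.2.2.1 p2
  have e3 : (∫ x in (-S)..0, y x * (Complex.exp (κ * (x + S)) *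
      (q x * (x / S) ^ 2 - 4 * κ * x / S ^ 2 - 2 / S ^ 2))) =
      (∫ t in (-S)..0, (((q t : ℂ) - -κ ^ 2) * y t * f t + dy t * f1 t)) -
      ∫ t in (-S)..0, (dy t * f1 t + y t * f2 t) := by
    rw [← intervalIntegral.integral_sub
      ((iy.mul_continuousOn c0.continuousOn).add (idy.mul_continuousOn c1.continuousOn))
      ((idy.mul_continuousOn c1.continuousOn).add
        ((h.intervalIntegrable_y hab).mul_continuousOn c2.continuousOn))]
    refine intervalIntegral.integral_congr fun t _ ↦ ?_
    simp only [hf, hf1, hf2]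
    ring
  have v0 : f (-S) = 1 := by simp [hf, hS']
  have v1 : f1 (-S) = κ - 2 / S := by
    simp [hf1]
    field_simp
    ring
  have w0 : f 0 = 0 := by simp [hf]
  have w1 : f1 0 = 0 := by simp [hf1]
  rw [e3, ← e1, ← e2, v0, v1, w0, w1]
  ring

/-- For Re κ ≤ 0 the exponential is at most 1 on [-S, 0], so Cauchy–Schwarz bounds the test integral
by the L² norm of `y`, with a factor that grows only like |κ|². -/
theorem norm_test_le {q : ℝ → ℝ} {S : ℝ} (hS : 0 < S)
    (hq : MemLp q 2 (volume.restrict (Set.Icc (-S) 0)))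
    {κ : ℂ} (hκ : κ.re ≤ 0) {y dy : ℝ → ℂ} (h : SolvesOn q (-κ ^ 2) (-S) 0 y dy) :
    ‖dy (-S) - y (-S) * (κ - 2 / S)‖ ^ 2 ≤ (∫ x in (-S)..0, ‖y x‖ ^ 2) *
      (2 * (∫ x in (-S)..0, q x ^ 2) + 2 * (S * (4 * ‖κ‖ / S + 2 / S ^ 2) ^ 2)) := by
  have hab : -S ≤ 0 := by linarith
  set c := 4 * ‖κ‖ / S + 2 / S ^ 2 with hc
  have hc0 : 0 ≤ c := by positivity
  have hqi : IntervalIntegrable q volume (-S) 0 := by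
    rw [intervalIntegrable_iff_integrableOn_Icc_of_le hab]
    exact hq.integrable (by norm_num)
  have hqsq : IntervalIntegrable (fun x ↦ q x ^ 2) volume (-S) 0 := by
    rw [intervalIntegrable_iff_integrableOn_Icc_of_le hab]
    exact hq.integrable_sq
  have hg : MemLp (fun x ↦ |q x| + c) 2 (volume.restrict (Set.Icc (-S) 0)) :=
    hq.abs.add (memLp_const c)
  have hgsq : IntervalIntegrable (fun x ↦ (|q x| + c) ^ 2) volume (-S) 0 := by
    rw [intervalIntegrable_iff_integrableOn_Icc_of_le hab]
    exact hg.integrable_sq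
  obtain ⟨i, cs⟩ := sq_integral_norm_mul_le hab h.1 hg
  have hle : ‖dy (-S) - y (-S) * (κ - 2 / S)‖ ≤ ∫ x in (-S)..0, ‖y x‖ * (|q x| + c) := by
    rw [h.test_identity hS hqi, norm_neg]
    refine intervalIntegral.norm_integral_le_of_norm_le hab ?_ i
    filter_upwards with x hx
    rw [norm_mul]
    refine mul_le_mul_of_nonneg_left ?_ (norm_nonneg _)
    have hx1 : 0 ≤ x + S := by linarith [hx.1]
    have hxS : |x| ≤ S := abs_le.2 ⟨hx.1.le, by linarith [hx.2]⟩
    have b1 : ‖Complex.exp (κ * (x + S))‖ ≤ 1 := by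
      rw [Complex.norm_exp, Real.exp_le_one_iff]
      simp
      exact mul_nonpos_of_nonpos_of_nonneg hκ hx1
    have b2 : ‖(q x : ℂ) * (x / S) ^ 2‖ ≤ |q x| := by
      rw [norm_mul, norm_pow, norm_div, Complex.norm_real, Complex.norm_real, Complex.norm_real,
        Real.norm_eq_abs, Real.norm_eq_abs, Real.norm_eq_abs, abs_of_pos hS]
      refine mul_le_of_le_one_right (abs_nonneg _) (pow_le_one₀ (by positivity) ?_)
      exact (div_le_one hS).2 hxS
    have b3 : ‖4 * κ * x / S ^ 2‖ ≤ 4 * ‖κ‖ / S := by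
      rw [norm_div, norm_mul, norm_mul, norm_pow, Complex.norm_real, Complex.norm_real,
        Real.norm_eq_abs, Real.norm_eq_abs, abs_of_pos hS]
      rw [div_le_div_iff₀ (by positivity) hS]
      have : 4 * ‖κ‖ * |x| * S ≤ 4 * ‖κ‖ * S * S := by gcongr
      simp
      linarith
    have b4 : ‖(2 : ℂ) / S ^ 2‖ = 2 / S ^ 2 := by
      simp
    rw [norm_mul]
    calc _ ≤ 1 * ‖(q x : ℂ) * (x / S) ^ 2 - 4 * κ * x / S ^ 2 - 2 / S ^ 2‖ :=
          mul_le_mul_of_nonneg_right b1 (norm_nonneg _)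
      _ ≤ |q x| + c := by
          rw [one_mul]
          refine (norm_sub_le _ _).trans ?_
          have := norm_sub_le ((q x : ℂ) * (x / S) ^ 2) (4 * κ * x / S ^ 2)
          rw [b4, hc]
          linarith
  have hgle : (∫ x in (-S)..0, (|q x| + c) ^ 2) ≤
      2 * (∫ x in (-S)..0, q x ^ 2) + 2 * (S * c ^ 2) := by
    calc _ ≤ ∫ x in (-S)..0, (2 * q x ^ 2 + 2 * c ^ 2) := by
          refine intervalIntegral.integral_mono_on hab hgsq
            ((hqsq.const_mul 2).add intervalIntegrable_const) fun x _ ↦ ?_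
          nlinarith [sq_nonneg (|q x| - c), sq_abs (q x)]
      _ = _ := by
          rw [intervalIntegral.integral_add (hqsq.const_mul 2) intervalIntegrable_const,
            intervalIntegral.integral_const_mul, intervalIntegral.integral_const, smul_eq_mul]
          ring
  calc _ ≤ (∫ x in (-S)..0, ‖y x‖ * (|q x| + c)) ^ 2 := by gcongr
    _ ≤ _ := cs
    _ ≤ _ := mul_le_mul_of_nonneg_left hgle (integral_norm_sq_nonneg hab y)

end SolvesOn

theorem im_two_mul_sq_mul_I (t : ℝ) : (2 * (t : ℂ) ^ 2 * Complex.I).im = 2 * t ^ 2 := by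
  rw [show (2 * (t : ℂ) ^ 2 * Complex.I) = ((2 * t ^ 2 : ℝ) : ℂ) * Complex.I by push_cast; rfl,
    Complex.mul_I_im, Complex.ofReal_re]

namespace TransferProblem.IsTerminalPair

variable {P : TransferProblem} {β : ℝ} {a b : ℂ → ℂ}

/-- The quadratic estimate behind the asymptotics of the `m`-function along the imaginary axis. -/
theorem exists_sq_norm_le (h : P.IsTerminalPair β a b) : ∃ A : ℝ, 0 ≤ A ∧ ∀ t : ℝ, 1 ≤ t →
    ‖b (2 * t ^ 2 * Complex.I) - a (2 * t ^ 2 * Complex.I) * ((Complex.I - 1) * t - 2 / P.S)‖ ^ 2 ≤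
      A * (‖a (2 * t ^ 2 * Complex.I)‖ * ‖b (2 * t ^ 2 * Complex.I)‖) := by
  have hS := P.S_pos
  set Q := ∫ x in (-P.S)..0, P.q x ^ 2 with hQ
  have hQ0 : 0 ≤ Q := intervalIntegral.integral_nonneg P.left_le fun _ _ ↦ sq_nonneg _
  set A := Q + P.S * (8 / P.S + 2 / P.S ^ 2) ^ 2 with hA
  refine ⟨A, by positivity, fun t ht ↦ ?_⟩
  set z : ℂ := 2 * t ^ 2 * Complex.I with hz
  have hzim : z.im = 2 * t ^ 2 := im_two_mul_sq_mul_I t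
  obtain ⟨ψ, hψ, e₀, e₁⟩ := P.exists_isSolution z (a z) (b z)
  -- The parametrization z = 2it² makes this square root of -z linear in t, with real part -t ≤ 0.
  set κ : ℂ := (Complex.I - 1) * t with hκ
  have hκz : z = -κ ^ 2 := by
    rw [hκ, hz]
    linear_combination (t : ℂ) ^ 2 * Complex.I_sq
  have hκre : κ.re ≤ 0 := by simp [hκ]; linarith
  have hκn : ‖κ‖ ≤ 2 * t := by
    rw [hκ, norm_mul, Complex.norm_real, Real.norm_of_nonneg (by linarith)]
    refine mul_le_mul_of_nonneg_right ((norm_sub_le _ _).trans ?_) (by linarith)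
    simp
    norm_num
  have hl := hψ.left_eq
  rw [hκz] at hl
  have hqm : MemLp P.q 2 (volume.restrict (Set.Icc (-P.S) 0)) :=
    P.q_memLp.mono_measure (Measure.restrict_mono (Set.Icc_subset_Icc_right hS.le) le_rfl)
  have key := hl.norm_test_le hS hqm hκre
  rw [e₀, e₁] at key
  have hI := h.integral_le hψ e₀ e₁ (by rw [hzim]; positivity)
  rw [hzim] at hI
  have hI2 : (b z * (starRingEnd ℂ) (a z)).im ≤ ‖a z‖ * ‖b z‖ := by
    refine (Complex.im_le_norm _).trans ?_
    rw [norm_mul, Complex.norm_conj, mul_comm]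
  set J := ∫ x in (-P.S)..0, ‖ψ.left x‖ ^ 2 with hJ
  have hJ0 : 0 ≤ J := SolvesOn.integral_norm_sq_nonneg P.left_le _
  have hb : 2 * Q + 2 * (P.S * (4 * ‖κ‖ / P.S + 2 / P.S ^ 2) ^ 2) ≤ 2 * t ^ 2 * A := by
    have h1 : 4 * ‖κ‖ / P.S + 2 / P.S ^ 2 ≤ t * (8 / P.S + 2 / P.S ^ 2) := by
      have : 4 * ‖κ‖ / P.S ≤ 4 * (2 * t) / P.S := by gcongr
      have h3 : 2 / P.S ^ 2 ≤ t * (2 / P.S ^ 2) := le_mul_of_one_le_left (by positivity) ht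
      have h4 : 4 * (2 * t) / P.S = t * (8 / P.S) := by ring
      linarith
    have h2 : (4 * ‖κ‖ / P.S + 2 / P.S ^ 2) ^ 2 ≤ (t * (8 / P.S + 2 / P.S ^ 2)) ^ 2 := by gcongr
    have h3 : P.S * (4 * ‖κ‖ / P.S + 2 / P.S ^ 2) ^ 2 ≤
      P.S * (t * (8 / P.S + 2 / P.S ^ 2)) ^ 2 := by gcongr
    have h4 : Q ≤ t ^ 2 * Q := le_mul_of_one_le_left hQ0 (one_le_pow₀ ht)
    rw [hA]
    nlinarith
  calc _ ≤ J * (2 * Q + 2 * (P.S * (4 * ‖κ‖ / P.S + 2 / P.S ^ 2) ^ 2)) := key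
    _ ≤ J * (2 * t ^ 2 * A) := by gcongr
    _ = A * (2 * t ^ 2 * J) := by ring
    _ ≤ _ := mul_le_mul_of_nonneg_left (hI.trans hI2) (by positivity)

open Filter Topology in
/-- Asymptotics of the `m`-function along the imaginary axis. -/
theorem tendsto_div (h : P.IsTerminalPair β a b) :
    Tendsto (fun t : ℝ ↦ b (2 * t ^ 2 * Complex.I) / a (2 * t ^ 2 * Complex.I) / t) atTop
      (𝓝 (Complex.I - 1)) := by
  obtain ⟨A, hA, hle⟩ := h.exists_sq_norm_le
  have hS := P.S_pos
  set w : ℝ → ℂ := fun t ↦ b (2 * t ^ 2 * Complex.I) / a (2 * t ^ 2 * Complex.I) / t with hw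
  -- The correction 2 / (S t) comes from the derivative of the cutoff at -S; with it the quadratic
  -- estimate reads |d|² ≤ (A / t) |w|, which forces d → 0.
  set d : ℝ → ℂ := fun t ↦ w t - (Complex.I - 1) + ((2 / P.S * t⁻¹ : ℝ) : ℂ) with hd
  have hbound : ∀ t : ℝ, 1 ≤ t → ‖d t‖ ^ 2 ≤
      (A * t⁻¹) ^ 2 + 2 * (A * t⁻¹) * (2 + 2 / P.S * t⁻¹) := by
    intro t ht
    have ht0 : 0 < t := by linarith
    have htc : (t : ℂ) ≠ 0 := by exact_mod_cast ht0.ne'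
    have hSc : (P.S : ℂ) ≠ 0 := by exact_mod_cast hS.ne'
    have ha : a (2 * t ^ 2 * Complex.I) ≠ 0 := h.fst_ne_zero (by
      rw [im_two_mul_sq_mul_I]
      positivity)
    have hl := hle t ht
    have e : b (2 * t ^ 2 * Complex.I) = a (2 * t ^ 2 * Complex.I) * (t * w t) := by
      rw [hw]; field_simp
    generalize a (2 * t ^ 2 * Complex.I) = az at *
    have e2 : b (2 * t ^ 2 * Complex.I) - az * ((Complex.I - 1) * t - 2 / P.S) = az * (t * d t) := by
      rw [e, hd]
      push_cast
      field_simp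
      ring
    rw [e2, e, norm_mul, norm_mul, norm_mul, norm_mul, Complex.norm_real,
      Real.norm_of_nonneg ht0.le] at hl
    have haz : 0 < ‖az‖ := norm_pos_iff.2 ha
    have hl2 : ‖d t‖ ^ 2 ≤ A * t⁻¹ * ‖w t‖ := by
      have : (‖az‖ ^ 2 * t ^ 2) * ‖d t‖ ^ 2 ≤ (‖az‖ ^ 2 * t ^ 2) * (A * t⁻¹ * ‖w t‖) := by
        calc _ = (‖az‖ * (t * ‖d t‖)) ^ 2 := by ring
          _ ≤ _ := hl
          _ = _ := by field_simp
      exact le_of_mul_le_mul_left this (by positivity)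
    have hwn : ‖w t‖ ≤ ‖d t‖ + (2 + 2 / P.S * t⁻¹) := by
      have e3 : w t = d t + ((Complex.I - 1) - ((2 / P.S * t⁻¹ : ℝ) : ℂ)) := by rw [hd]; ring
      rw [e3]
      refine (norm_add_le _ _).trans (add_le_add le_rfl ((norm_sub_le _ _).trans ?_))
      refine add_le_add ((norm_sub_le _ _).trans (by simp; norm_num)) ?_
      rw [Complex.norm_real, Real.norm_of_nonneg (by positivity)]
    have hε : 0 ≤ A * t⁻¹ := by positivity
    have : ‖d t‖ ^ 2 ≤ A * t⁻¹ * (‖d t‖ + (2 + 2 / P.S * t⁻¹)) :=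
      hl2.trans (mul_le_mul_of_nonneg_left hwn hε)
    nlinarith [sq_nonneg (‖d t‖ - A * t⁻¹)]
  have hinv : Tendsto (fun t : ℝ ↦ t⁻¹) atTop (𝓝 0) := tendsto_inv_atTop_zero
  have hup : Tendsto (fun t : ℝ ↦ (A * t⁻¹) ^ 2 + 2 * (A * t⁻¹) * (2 + 2 / P.S * t⁻¹)) atTop
      (𝓝 0) := by
    have := (((hinv.const_mul A).pow 2)).add (((hinv.const_mul A).const_mul 2).mul
      ((hinv.const_mul (2 / P.S)).const_add 2))
    simpa using this
  have hsq : Tendsto (fun t ↦ ‖d t‖ ^ 2) atTop (𝓝 0) := by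
    refine squeeze_zero' (Eventually.of_forall fun _ ↦ by positivity) ?_ hup
    filter_upwards [eventually_ge_atTop 1] with t ht using hbound t ht
  have hdlim : Tendsto d atTop (𝓝 0) := by
    rw [tendsto_zero_iff_norm_tendsto_zero]
    have := hsq.sqrt
    simpa [Real.sqrt_sq] using this
  have hc : Tendsto (fun t : ℝ ↦ ((2 / P.S * t⁻¹ : ℝ) : ℂ)) atTop (𝓝 0) := by
    have := (Complex.continuous_ofReal.tendsto _).comp (hinv.const_mul (2 / P.S))
    rwa [mul_zero, Complex.ofReal_zero] at this
  have := (hdlim.add_const (Complex.I - 1)).sub hc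
  simp only [zero_add, sub_zero] at this
  refine this.congr fun t ↦ ?_
  rw [hd]
  ring

end TransferProblem.IsTerminalPair

open Filter Topology in
-- For s ≠ 0 the term linear in t dominates and the common limit `L` cancels; for s = 0 both sides
-- equal c.
theorem tendsto_sub_div_sub {w₁ w₂ : ℝ → ℂ} {L : ℂ} (hL : L ≠ 0) (h₁ : Tendsto w₁ atTop (𝓝 L))
    (h₂ : Tendsto w₂ atTop (𝓝 L)) {c s : ℂ} (hcs : s = 0 → c ≠ 0) :
    Tendsto (fun t : ℝ ↦ (c - t * w₁ t * s) / (c - t * w₂ t * s)) atTop (𝓝 1) := by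
  by_cases hs : s = 0
  · have hc := hcs hs
    simp [hs, hc]
  · have hinv : Tendsto (fun t : ℝ ↦ c * ((t⁻¹ : ℝ) : ℂ)) atTop (𝓝 0) := by
      have := ((Complex.continuous_ofReal.tendsto _).comp tendsto_inv_atTop_zero).const_mul c
      rwa [Complex.ofReal_zero, mul_zero] at this
    have h := (hinv.sub (h₁.mul_const s)).div (hinv.sub (h₂.mul_const s))
      (by simp [hL, hs])
    rw [div_self (by simp [hL, hs])] at h
    refine h.congr' ?_
    filter_upwards [eventually_gt_atTop 0] with t ht
    have htc : (t : ℂ) ≠ 0 := by exact_mod_cast ht.ne'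
    simp only [Pi.div_apply]
    have e : ∀ w : ℂ, c * ((t⁻¹ : ℝ) : ℂ) - w * s = (c - t * w * s) / t := by
      intro w; push_cast; field_simp
    rw [e, e, div_div_div_cancel_right₀ htc]

/-! ### Two spectra determine the m-function -/

namespace TransferProblem

theorem sin_sub_ne_zero {α α' : ℝ} (hα : α ∈ Set.Ico 0 Real.pi) (hα' : α' ∈ Set.Ico 0 Real.pi)
    (hne : α' ≠ α) : Real.sin (α - α') ≠ 0 := fun h ↦
  hne (sub_eq_zero.1 ((Real.sin_eq_zero_iff_of_lt_of_lt (by linarith [hα.1, hα'.2])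
    (by linarith [hα.2, hα'.1])).1 h)).symm

theorem sin_ne_zero_or_cos_ne_zero (θ : ℝ) : (Real.sin θ : ℂ) = 0 → (Real.cos θ : ℂ) ≠ 0 := by
  intro h h'
  have hcs := Real.cos_sq_add_sin_sq θ
  rw [Complex.ofReal_eq_zero] at h h'
  rw [h, h'] at hcs
  norm_num at hcs

namespace IsTerminalPair

variable {P P₁ P₂ : TransferProblem} {α α' β β₁ β₂ : ℝ} {a b a₁ b₁ a₂ b₂ : ℂ → ℂ} {lam mu : ℕ → ℝ}

theorem eq_zero_iff_of_isSpectrum (h : P.IsTerminalPair β a b) (hl : P.IsSpectrum α β lam) (z : ℂ) :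
    a z * Real.cos α - b z * Real.sin α = 0 ↔ ∃ n, (lam n : ℂ) = z := by
  rw [← h.isEigenvalue_iff, hl.2]

theorem im_eq_zero_of_isSpectrum (h : P.IsTerminalPair β a b) (hl : P.IsSpectrum α β lam) (z : ℂ)
    (hz : a z * Real.cos α - b z * Real.sin α = 0) : z.im = 0 := by
  obtain ⟨n, rfl⟩ := (h.eq_zero_iff_of_isSpectrum hl z).1 hz
  simp

/-- The prefactor sin(α - α') fixes the sign: with it Im(N conj D) = sin²(α - α') Im(b conj a).
Zeros are real because the listed eigenvalues are, and a common zero would make a and b both vanish.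
-/
theorem isHerglotzPair (h : P.IsTerminalPair β a b) (hk : Real.sin (α - α') ≠ 0)
    (hl : P.IsSpectrum α β lam) (hm : P.IsSpectrum α' β mu) :
    IsHerglotzPair (fun z ↦ (Real.sin (α - α') : ℂ) * (a z * Real.cos α' - b z * Real.sin α'))
      (fun z ↦ a z * Real.cos α - b z * Real.sin α) := by
  have hkc : (Real.sin (α - α') : ℂ) ≠ 0 := by exact_mod_cast hk
  have key : ∀ z, ((Real.sin (α - α') : ℂ) * (a z * Real.cos α' - b z * Real.sin α') *
      (starRingEnd ℂ) (a z * Real.cos α - b z * Real.sin α)).im =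
      Real.sin (α - α') ^ 2 * (b z * (starRingEnd ℂ) (a z)).im := by
    intro z
    rw [Real.sin_sub]
    simp [-Complex.ofReal_cos, -Complex.ofReal_sin]
    ring
  have hk2 : 0 < Real.sin (α - α') ^ 2 := by positivity
  refine ⟨?_, ?_, fun z hz ↦ ?_, fun z hz ↦ h.im_eq_zero_of_isSpectrum hl z hz, fun z hz hD ↦ ?_,
    fun z hz ↦ ?_, fun z hz ↦ ?_, fun z hz ↦ ?_⟩
  · exact ((h.diff_fst.mul_const _).sub (h.diff_snd.mul_const _)).const_mul _
  · exact (h.diff_fst.mul_const _).sub (h.diff_snd.mul_const _)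
  · exact h.im_eq_zero_of_isSpectrum hm z ((mul_eq_zero.1 hz).resolve_left hkc)
  · have hN := (mul_eq_zero.1 hz).resolve_left hkc
    have ek : (Real.sin (α - α') : ℂ) = Real.sin α * Real.cos α' - Real.cos α * Real.sin α' := by
      rw [Real.sin_sub]; push_cast; rfl
    have h1 : (Real.sin (α - α') : ℂ) * a z = 0 := by
      rw [ek]; linear_combination (Real.sin α : ℂ) * hN - Real.sin α' * hD
    have h2 : (Real.sin (α - α') : ℂ) * b z = 0 := by
      rw [ek]; linear_combination (Real.cos α : ℂ) * hN - Real.cos α' * hD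
    rcases h.ne_zero z with h0 | h0
    · exact h0 ((mul_eq_zero.1 h1).resolve_left hkc)
    · exact h0 ((mul_eq_zero.1 h2).resolve_left hkc)
  · obtain ⟨p, hp, e⟩ := h.im_mul_conj_eq z
    rw [key, e]
    positivity
  · obtain ⟨p, hp, e⟩ := h.im_mul_conj_eq z
    rw [key, e]
    exact mul_neg_of_pos_of_neg hk2 (mul_neg_of_neg_of_pos hz hp)
  · obtain ⟨p, hp, e⟩ := h.im_mul_conj_eq z
    rw [key, e, hz]
    simp

open Filter Topology in
/-- Problems with the same two spectra have the same quotient of characteristic functions. -/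
theorem mul_eq_mul (h₁ : P₁.IsTerminalPair β₁ a₁ b₁) (h₂ : P₂.IsTerminalPair β₂ a₂ b₂)
    (hk : Real.sin (α - α') ≠ 0)
    (hl₁ : P₁.IsSpectrum α β₁ lam) (hm₁ : P₁.IsSpectrum α' β₁ mu)
    (hl₂ : P₂.IsSpectrum α β₂ lam) (hm₂ : P₂.IsSpectrum α' β₂ mu) (z : ℂ) :
    (a₁ z * Real.cos α' - b₁ z * Real.sin α') * (a₂ z * Real.cos α - b₂ z * Real.sin α) =
      (a₁ z * Real.cos α - b₁ z * Real.sin α) * (a₂ z * Real.cos α' - b₂ z * Real.sin α') := by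
  have hkc : (Real.sin (α - α') : ℂ) ≠ 0 := by exact_mod_cast hk
  obtain ⟨C, hC⟩ := (h₁.isHerglotzPair hk hl₁ hm₁).proportional (h₂.isHerglotzPair hk hl₂ hm₂)
    (fun z ↦ by
      rw [mul_eq_zero, mul_eq_zero, or_iff_right hkc, or_iff_right hkc,
        h₁.eq_zero_iff_of_isSpectrum hm₁, h₂.eq_zero_iff_of_isSpectrum hm₂])
    (fun z ↦ by rw [h₁.eq_zero_iff_of_isSpectrum hl₁, h₂.eq_zero_iff_of_isSpectrum hl₂])
    ⟨mu 0, by rw [(h₁.eq_zero_iff_of_isSpectrum hm₁ _).2 ⟨0, rfl⟩, mul_zero]⟩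
  have hC' : ∀ z, (a₁ z * Real.cos α' - b₁ z * Real.sin α') *
      (a₂ z * Real.cos α - b₂ z * Real.sin α) = C * ((a₁ z * Real.cos α - b₁ z * Real.sin α) *
        (a₂ z * Real.cos α' - b₂ z * Real.sin α')) := fun z ↦
    mul_left_cancel₀ hkc (by linear_combination hC z)
  have hL : Complex.I - 1 ≠ 0 := fun h ↦ by
    have := congrArg Complex.im h
    simp at this
  have t₁ := h₁.tendsto_div
  have t₂ := h₂.tendsto_div
  -- The double ratio of characteristic functions equals C at every point 2it² with t > 0, while the
  -- common asymptotics of b / a send it to 1; the factors a₁ and a₂ cancel.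
  have r := (tendsto_sub_div_sub hL t₁ t₂ (sin_ne_zero_or_cos_ne_zero α')).div
    (tendsto_sub_div_sub hL t₁ t₂ (sin_ne_zero_or_cos_ne_zero α)) one_ne_zero
  rw [div_one] at r
  have hC1 : C = 1 := by
    refine tendsto_nhds_unique (tendsto_const_nhds.congr' ?_) r
    filter_upwards [eventually_gt_atTop 0] with t ht
    have htc : (t : ℂ) ≠ 0 := by exact_mod_cast ht.ne'
    have him : (2 * (t : ℂ) ^ 2 * Complex.I).im ≠ 0 := by
      rw [im_two_mul_sq_mul_I]; positivity
    have ha₁ := h₁.fst_ne_zero him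
    have ha₂ := h₂.fst_ne_zero him
    have e := hC' (2 * (t : ℂ) ^ 2 * Complex.I)
    have n₁ : a₁ (2 * t ^ 2 * Complex.I) * Real.cos α - b₁ (2 * t ^ 2 * Complex.I) * Real.sin α ≠ 0 :=
      fun h ↦ him (h₁.im_eq_zero_of_isSpectrum hl₁ _ h)
    have n₂ : a₂ (2 * t ^ 2 * Complex.I) * Real.cos α - b₂ (2 * t ^ 2 * Complex.I) * Real.sin α ≠ 0 :=
      fun h ↦ him (h₂.im_eq_zero_of_isSpectrum hl₂ _ h)
    have n₃ : a₂ (2 * t ^ 2 * Complex.I) * Real.cos α' - b₂ (2 * t ^ 2 * Complex.I) * Real.sin α' ≠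
      0 := fun h ↦ him (h₂.im_eq_zero_of_isSpectrum hm₂ _ h)
    have f : ∀ {x y : ℂ} (c s : ℂ), x ≠ 0 → c - t * (y / x / t) * s = (x * c - y * s) / x := by
      intro x y c s hx
      field_simp
    simp only [Pi.div_apply]
    rw [f _ _ ha₁, f _ _ ha₂, f _ _ ha₁, f _ _ ha₂, eq_div_iff (by positivity)]
    rw [div_div_div_eq, div_div_div_eq, mul_div_assoc', div_eq_div_iff (by positivity)
      (by positivity)]
    linear_combination (-(a₁ (2 * t ^ 2 * Complex.I)) * a₂ (2 * t ^ 2 * Complex.I)) * e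
  rw [hC' z, hC1, one_mul]

/-- Rotating by the angle α - α' gives N = cos(α - α') D + sin(α - α') (a sin α + b cos α), so
equality of N / D for the two problems passes to their m-functions. -/
theorem isWeylValue_congr (h₁ : P₁.IsTerminalPair β₁ a₁ b₁) (h₂ : P₂.IsTerminalPair β₂ a₂ b₂)
    (hk : Real.sin (α - α') ≠ 0)
    (hl₁ : P₁.IsSpectrum α β₁ lam) (hm₁ : P₁.IsSpectrum α' β₁ mu)
    (hl₂ : P₂.IsSpectrum α β₂ lam) (hm₂ : P₂.IsSpectrum α' β₂ mu) {z m : ℂ}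
    (hz : ¬ P₁.IsEigenvalue α β₁ z) (hw : P₁.IsWeylValue α β₁ z m) : P₂.IsWeylValue α β₂ z m := by
  rw [h₁.isEigenvalue_iff] at hz
  rw [h₁.isWeylValue_iff] at hw
  rw [h₂.isWeylValue_iff]
  have hkc : (Real.sin (α - α') : ℂ) ≠ 0 := by exact_mod_cast hk
  have e := h₁.mul_eq_mul h₂ hk hl₁ hm₁ hl₂ hm₂ z
  have ek : (Real.sin (α - α') : ℂ) = Real.sin α * Real.cos α' - Real.cos α * Real.sin α' := by
    rw [Real.sin_sub]; push_cast; rfl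
  have ec : (Real.sin α : ℂ) ^ 2 + (Real.cos α : ℂ) ^ 2 = 1 := by
    exact_mod_cast Real.sin_sq_add_cos_sq α
  have hcos : ∀ x y : ℂ, x * Real.cos α' - y * Real.sin α' =
      (Real.cos α * Real.cos α' + Real.sin α * Real.sin α') * (x * Real.cos α - y * Real.sin α) +
      Real.sin (α - α') * (x * Real.sin α + y * Real.cos α) := fun x y ↦ by
    rw [ek]
    linear_combination (-(x * Real.cos α') + y * Real.sin α') * ec
  rw [hcos, hcos] at e
  have e2 : (a₁ z * Real.sin α + b₁ z * Real.cos α) * (a₂ z * Real.cos α - b₂ z * Real.sin α) =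
      (a₁ z * Real.cos α - b₁ z * Real.sin α) * (a₂ z * Real.sin α + b₂ z * Real.cos α) :=
    mul_left_cancel₀ hkc (by linear_combination e)
  refine mul_left_cancel₀ hz ?_
  rw [← e2, ← hw]
  ring

end IsTerminalPair

/-- `m` is the value at `z` of the `m`-function of some problem with the given spectra. -/
def IsWeylValueOfSpectra (lam mu : ℕ → ℝ) (α α' : ℝ) (z m : ℂ) : Prop :=
  ∃ (P : TransferProblem) (β : ℝ), P.IsSpectrum α β lam ∧ P.IsSpectrum α' β mu ∧
    ¬ P.IsEigenvalue α β z ∧ P.IsWeylValue α β z m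

end TransferProblem

/-- One and the same rule `R` recovers the Titchmarsh-Weyl `m`-function of every problem from the
two spectra and the two angles `α`, `α'`; it is given neither `S`, `q`, `M` nor `β`. At every `z`
that is not an eigenvalue (for `α`, `β`), the value of the `m`-function exists, is unique, and is
the one given by `R`. -/
theorem theorem3p1 :
    ∃ R : (ℕ → ℝ) → (ℕ → ℝ) → ℝ → ℝ → (ℂ → ℂ),
      ∀ (P : TransferProblem) (α α' β : ℝ),
        α ∈ Set.Ico 0 Real.pi → α' ∈ Set.Ico 0 Real.pi → α' ≠ α → β ∈ Set.Ioc 0 Real.pi →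
        ∀ lam mu : ℕ → ℝ, P.IsSpectrum α β lam → P.IsSpectrum α' β mu →
          ∀ z : ℂ, ¬ P.IsEigenvalue α β z →
            ∀ m : ℂ, P.IsWeylValue α β z m ↔ m = R lam mu α α' z := by
  classical
  -- The rule takes the value of any problem with these spectra. The default 0 is never reached
  -- here, as the given problem is itself a witness, and `isWeylValue_congr` makes the choice
  -- immaterial.
  refine ⟨fun lam mu α α' z ↦
    if h : ∃ m, TransferProblem.IsWeylValueOfSpectra lam mu α α' z m then h.choose else 0,
    fun P α α' β hα hα' hne _ lam mu hl hm z hz m ↦ ?_⟩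
  obtain ⟨a, b, h⟩ := P.exists_isTerminalPair β
  have hk := TransferProblem.sin_sub_ne_zero hα hα' hne
  have hD := (h.isEigenvalue_iff α z).not.1 hz
  have hex : ∃ m, TransferProblem.IsWeylValueOfSpectra lam mu α α' z m :=
    ⟨_, P, β, hl, hm, hz, (h.isWeylValue_iff α z _).2 (div_mul_cancel₀ _ hD)⟩
  beta_reduce
  rw [dif_pos hex]
  obtain ⟨P', β', hl', hm', hz', hw'⟩ := hex.choose_spec
  obtain ⟨a', b', h'⟩ := P'.exists_isTerminalPair β'
  have hw := h'.isWeylValue_congr h hk hl' hm' hl hm hz' hw'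
  constructor
  · intro hmw
    rw [h.isWeylValue_iff] at hmw hw
    exact mul_right_cancel₀ hD (hmw.trans hw.symm)
  · rintro rfl
    exact hw
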